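/- Let $k$ be a commutative ring. All coalgebras and algebras are $k$-coalgebras (coassociative, counital) and $k$-algebras (associative, unital) whose underlying $k$-modules are finitely generated and projective. With the usual tensor products they form monoidal categories $\mathcal{C}$ (coalgebras and coalgebra morphisms) and $\mathcal{A}$ (algebras and algebra morphisms), both with unit object $k$. Let ${}_{\mathcal{C}}\mathrm{Cat}$ be the 2-category of $\mathcal{C}$-categories. A $\mathcal{C}$-category $A$ has objects $x,y,\dots$, coalgebras $A_{x,y}$ and coalgebra morphisms $m_{x,y,z}:A_{x,y}\otimes A_{y,z}\to A_{x,z}$, $\eta_x:k\to A_{x,x}$ satisfying associativity and unitality. A 1-cell $f:A\to B$ is a $\mathcal{C}$-functor, given by a map on objects and morphisms $f_{x,y}:A_{x,y}\to B_{f(x),f(y)}$ in $\mathcal{C}$ compatible with $m$ and $\eta$. A 2-cell $\alpha:f\Rightarrow g$ is a family of morphisms $\alpha_x:k\to B_{g(x),f(x)}$ in $\mathcal{C}$ with $m\circ(g_{x,y}\otimes\alpha_y)=m\circ(\alpha_x\otimes f_{x,y})$ on $A_{x,y}$ for all $x,y$. Vertical composition is $(\beta\circ\alpha)_x=m\circ(\beta_x\otimes\alpha_x)$.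 Dually, let ${}^{\mathcal{A}}\mathrm{Cat}$ be the 2-category of dual $\mathcal{A}$-categories. A dual $\mathcal{A}$-category $C$ has objects, algebras $C_{x,y}$ and algebra morphisms $\Delta_{x,y,z}:C_{x,z}\to C_{x,y}\otimes C_{y,z}$, $\varepsilon_x:C_{x,x}\to k$ that are coassociative and satisfy $(\varepsilon_x\otimes C_{x,y})\circ\Delta_{x,x,y}=\mathrm{id}=(C_{x,y}\otimes\varepsilon_y)\circ\Delta_{x,y,y}$. A 1-cell $f:C\to D$ is given by a map on objects and morphisms $f_{x,y}:D_{f(x),f(y)}\to C_{x,y}$ in $\mathcal{A}$ compatible with $\Delta$ and $\varepsilon$. A 2-cell $\alpha:f\Rightarrow g$ is a family of morphisms $\alpha_x:D_{f(x),g(x)}\to k$ in $\mathcal{A}$ with $(f_{x,y}\otimes\alpha_y)\circ\Delta=(\alpha_x\otimes g_{x,y})\circ\Delta$ on $D_{f(x),g(y)}$ for all $x,y$. Vertical composition is $(\beta\circ\alpha)_x=(\alpha_x\otimes\beta_x)\circ\Delta$. For a coalgebra $C$ let $C^*=\mathrm{Hom}_k(C,k)$ be the algebra with unit the counit of $C$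 and product the opposite convolution $\langle c^*d^*,c\rangle=\langle c^*,c_{(2)}\rangle\langle d^*,c_{(1)}\rangle$. For coalgebras $C,D$ let $\iota:D^*\otimes C^*\to(C\otimes D)^*$ be the isomorphism of algebras with $\langle\iota(d^*\otimes c^*),c\otimes d\rangle=\langle d^*,d\rangle\langle c^*,c\rangle$. The duality $(-)^*$ sends a $\mathcal{C}$-category $A$ to the dual $\mathcal{A}$-category with the same objects, with $(x,y)$-component $A_{y,x}^*$, with comultiplications $\Delta_{x,y,z}=\iota^{-1}\circ m_{z,y,x}^*:A_{z,x}^*\to A_{y,x}^*\otimes A_{z,y}^*$ and counits $\eta_x^*:A_{x,x}^*\to k^*\cong k$. It sends a $\mathcal{C}$-functor $f$ to the dual $\mathcal{A}$-functor with the same object map and with $(x,y)$-component $f_{y,x}^*$, and a $\mathcal{C}$-natural transformation $\alpha$ to the family of the $\alpha_x^*$ (followed by $k^*\cong k$). Theorem. This defines a 2-functor ${}_{\mathcal{C}}\mathrm{Cat}\to{}^{\mathcal{A}}\mathrm{Cat}$, and it is a biequivalence: there is a pseudofunctor in the opposite direction such that both composites are equivalent to the identity pseudofunctors, in the bicategories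 of pseudofunctors, pseudonatural transformations and modifications. -/

import Mathlib

open CategoryTheory
open MonoidalCategory hiding tensorHom_def

universe w v u

/-- A (small) category enriched in the monoidal category `V`: a type `carrier` of objects, the
objects `A_{x,y} = Hom x y` of `V`, the multiplications `A_{x,y} ⊗ A_{y,z} ⟶ A_{x,z}` and the units
`𝟙 ⟶ A_{x,x}` of Mathlib's `EnrichedCategory`. -/
structure VCat (V : Type u) [Category.{v} V] [MonoidalCategory V] where
  /-- The objects. -/
  carrier : Type w
  [str : EnrichedCategory V carrier]

namespace VCat

variable {V : Type u} [Category.{v} V] [MonoidalCategory V]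

attribute [instance] VCat.str

/-- The object `A_{x,y}` of `V`. -/
abbrev hom (A : VCat.{w} V) (x y : A.carrier) : V := EnrichedCategory.Hom x y

/-- For a point `p : 𝟙 ⟶ A_{x,y}` and `a : X ⟶ A_{y,z}`, the product `m ∘ (p ⊗ a)`. -/
def lmul {A : VCat.{w} V} {X : V} {x y z : A.carrier} (p : 𝟙_ V ⟶ A.hom x y) (a : X ⟶ A.hom y z) :
    X ⟶ A.hom x z :=
  (λ_ X).inv ≫ (p ⊗ₘ a) ≫ eComp V x y z

/-- For a point `p : 𝟙 ⟶ A_{y,z}` and `a : X ⟶ A_{x,y}`, the product `m ∘ (a ⊗ p)`. -/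
def rmul {A : VCat.{w} V} {X : V} {x y z : A.carrier} (a : X ⟶ A.hom x y) (p : 𝟙_ V ⟶ A.hom y z) :
    X ⟶ A.hom x z :=
  (ρ_ X).inv ≫ (a ⊗ₘ p) ≫ eComp V x y z

section calculus

variable {A B : VCat.{w} V} {X Y : V} {x y z t : A.carrier}

lemma comp_lmul (f : Y ⟶ X) (p : 𝟙_ V ⟶ A.hom x y) (a : X ⟶ A.hom y z) :
    f ≫ lmul p a = lmul p (f ≫ a) := by
  simp only [lmul, MonoidalCategory.tensorHom_def', leftUnitor_inv_naturality_assoc,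
    MonoidalCategory.whiskerLeft_comp, Category.assoc]

lemma comp_rmul (f : Y ⟶ X) (a : X ⟶ A.hom x y) (p : 𝟙_ V ⟶ A.hom y z) :
    f ≫ rmul a p = rmul (f ≫ a) p := by
  simp only [rmul, MonoidalCategory.tensorHom_def, rightUnitor_inv_naturality_assoc,
    MonoidalCategory.comp_whiskerRight, Category.assoc]

lemma rmul_eq_lmul (p : 𝟙_ V ⟶ A.hom x y) (q : 𝟙_ V ⟶ A.hom y z) : rmul p q = lmul p q := by
  simp [rmul, lmul, unitors_inv_equal]

lemma lmul_eId (a : X ⟶ A.hom x y) : lmul (eId V x) a = a := by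
  have := e_id_comp V x y
  simp only [lmul, MonoidalCategory.tensorHom_def', Category.assoc,
    ← leftUnitor_inv_naturality_assoc]
  rw [this, Category.comp_id]

lemma rmul_eId (a : X ⟶ A.hom x y) : rmul a (eId V y) = a := by
  have := e_comp_id V x y
  simp only [rmul, MonoidalCategory.tensorHom_def, Category.assoc,
    ← rightUnitor_inv_naturality_assoc]
  rw [this, Category.comp_id]

lemma eComp_assoc {X Y Z : V} (a : X ⟶ A.hom x y) (b : Y ⟶ A.hom y z) (c : Z ⟶ A.hom z t) :
    (((a ⊗ₘ b) ≫ eComp V x y z) ⊗ₘ c) ≫ eComp V x z t =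
      (α_ X Y Z).hom ≫ (a ⊗ₘ ((b ⊗ₘ c) ≫ eComp V y z t)) ≫ eComp V x y t := by
  have := e_assoc' V x y z t
  calc _ = ((a ⊗ₘ b) ⊗ₘ c) ≫ eComp V x y z ▷ _ ≫ eComp V x z t := by
          simp [MonoidalCategory.tensorHom_def']
    _ = ((a ⊗ₘ b) ⊗ₘ c) ≫ (α_ _ _ _).hom ≫ _ ◁ eComp V y z t ≫ eComp V x y t := by rw [← this]
    _ = _ := by
          rw [associator_naturality_assoc]
          simp [MonoidalCategory.tensorHom_def]

lemma comp_tensor_eComp {X Y X' Y' : V} (f : X' ⟶ X) (g : Y' ⟶ Y) (a : X ⟶ A.hom x y)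
    (b : Y ⟶ A.hom y z) :
    (f ⊗ₘ g) ≫ (a ⊗ₘ b) ≫ eComp V x y z = ((f ≫ a) ⊗ₘ (g ≫ b)) ≫ eComp V x y z := by
  simp

lemma lmul_lmul (p : 𝟙_ V ⟶ A.hom x y) (q : 𝟙_ V ⟶ A.hom y z) (a : X ⟶ A.hom z t) :
    lmul p (lmul q a) = lmul (lmul p q) a := by
  have := eComp_assoc p q a
  simp only [lmul]
  rw [← Category.id_comp a, ← comp_tensor_eComp, Category.id_comp a, this,
    ← Category.id_comp p, ← comp_tensor_eComp, Category.id_comp p]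
  simp only [← Category.assoc]
  congr 2
  monoidal

lemma lmul_rmul (p : 𝟙_ V ⟶ A.hom x y) (a : X ⟶ A.hom y z) (q : 𝟙_ V ⟶ A.hom z t) :
    lmul p (rmul a q) = rmul (lmul p a) q := by
  have := eComp_assoc p a q
  have h1 : lmul p (rmul a q) = ((λ_ X).inv ≫ (𝟙_ V ◁ (ρ_ X).inv)) ≫
      (p ⊗ₘ ((a ⊗ₘ q) ≫ eComp V y z t)) ≫ eComp V x y t := by
    simp only [lmul, rmul, Category.assoc]
    rw [← id_tensorHom, comp_tensor_eComp, Category.id_comp]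
  have h2 : rmul (lmul p a) q = ((ρ_ X).inv ≫ ((λ_ X).inv ▷ 𝟙_ V)) ≫
      (((p ⊗ₘ a) ≫ eComp V x y z) ⊗ₘ q) ≫ eComp V x z t := by
    simp only [lmul, rmul, Category.assoc]
    rw [← tensorHom_id, comp_tensor_eComp, Category.id_comp]
  have h3 : (λ_ X).inv ≫ (𝟙_ V ◁ (ρ_ X).inv) =
      ((ρ_ X).inv ≫ ((λ_ X).inv ▷ 𝟙_ V)) ≫ (α_ _ _ _).hom := by monoidal
  rw [h1, h2, this, h3, Category.assoc _ (α_ _ _ _).hom]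

lemma rmul_rmul (a : X ⟶ A.hom x y) (p : 𝟙_ V ⟶ A.hom y z) (q : 𝟙_ V ⟶ A.hom z t) :
    rmul (rmul a p) q = rmul a (lmul p q) := by
  have := eComp_assoc a p q
  have h1 : rmul a (lmul p q) = ((ρ_ X).inv ≫ (X ◁ (λ_ (𝟙_ V)).inv)) ≫
      (a ⊗ₘ ((p ⊗ₘ q) ≫ eComp V y z t)) ≫ eComp V x y t := by
    simp only [lmul, rmul, Category.assoc]
    rw [← id_tensorHom, comp_tensor_eComp, Category.id_comp]
  have h2 : rmul (rmul a p) q = ((ρ_ X).inv ≫ ((ρ_ X).inv ▷ 𝟙_ V)) ≫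
      (((a ⊗ₘ p) ≫ eComp V x y z) ⊗ₘ q) ≫ eComp V x z t := by
    simp only [rmul, Category.assoc]
    rw [← tensorHom_id, comp_tensor_eComp, Category.id_comp]
  have h3 : (ρ_ X).inv ≫ (X ◁ (λ_ (𝟙_ V)).inv) =
      ((ρ_ X).inv ≫ ((ρ_ X).inv ▷ 𝟙_ V)) ≫ (α_ _ _ _).hom := by monoidal
  rw [h1, h2, this, h3, Category.assoc _ (α_ _ _ _).hom]

lemma lmul_pt_eId (p : 𝟙_ V ⟶ A.hom x y) : lmul p (eId V y) = p := by
  rw [← rmul_eq_lmul, rmul_eId]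

end calculus

/-- A `V`-functor `A → B`. -/
@[ext]
structure Functor (A B : VCat.{w} V) where
  /-- The underlying enriched functor. -/
  fn : EnrichedFunctor V A.carrier B.carrier

namespace Functor

/-- The value of a `V`-functor on objects. -/
abbrev obj {A B : VCat.{w} V} (f : Functor A B) (x : A.carrier) : B.carrier := f.fn.obj x

/-- The morphism `f_{x,y} : A_{x,y} ⟶ B_{f x, f y}`. -/
abbrev map {A B : VCat.{w} V} (f : Functor A B) (x y : A.carrier) :
    A.hom x y ⟶ B.hom (f.obj x) (f.obj y) := f.fn.map x y

/-- The identity `V`-functor. -/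
def id (A : VCat.{w} V) : Functor A A := ⟨EnrichedFunctor.id V A.carrier⟩

/-- The composition of `V`-functors, in diagrammatic order. -/
def comp {A B C : VCat.{w} V} (f : Functor A B) (g : Functor B C) : Functor A C :=
  ⟨f.fn.comp V g.fn⟩

variable {A B : VCat.{w} V} {X : V} {x y z : A.carrier} (f : Functor A B)

lemma lmul_map (p : 𝟙_ V ⟶ A.hom x y) (a : X ⟶ A.hom y z) :
    lmul p a ≫ f.map x z = lmul (p ≫ f.map x y) (a ≫ f.map y z) := by
  simp [lmul, f.fn.map_comp]

lemma rmul_map (a : X ⟶ A.hom x y) (p : 𝟙_ V ⟶ A.hom y z) :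
    rmul a p ≫ f.map x z = rmul (a ≫ f.map x y) (p ≫ f.map y z) := by
  simp [rmul, f.fn.map_comp]

lemma eId_map (x : A.carrier) : eId V x ≫ f.map x x = eId V (f.obj x) := f.fn.map_id x

end Functor

/-- A `V`-natural transformation `f ⇒ g`: morphisms `α_x : 𝟙 ⟶ B_{g x, f x}` with
`m ∘ (g_{x,y} ⊗ α_y) = m ∘ (α_x ⊗ f_{x,y})` on `A_{x,y}`. -/
@[ext]
structure NatTrans {A B : VCat.{w} V} (f g : Functor A B) where
  /-- The components. -/
  app (x : A.carrier) : 𝟙_ V ⟶ B.hom (g.obj x) (f.obj x)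
  naturality (x y : A.carrier) :
    (ρ_ (A.hom x y)).inv ≫ (g.map x y ⊗ₘ app y) ≫ eComp V _ _ _ =
      (λ_ (A.hom x y)).inv ≫ (app x ⊗ₘ f.map x y) ≫ eComp V _ _ _

namespace NatTrans

variable {A B C : VCat.{w} V}

lemma nat {f g : Functor A B} (α : NatTrans f g) (x y : A.carrier) :
    rmul (g.map x y) (α.app y) = lmul (α.app x) (f.map x y) := α.naturality x y

/-- Naturality on a generalized element `a : X ⟶ A_{x,y}`. -/
lemma nat' {f g : Functor A B} (α : NatTrans f g) {X : V} {x y : A.carrier} (a : X ⟶ A.hom x y) :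
    rmul (a ≫ g.map x y) (α.app y) = lmul (α.app x) (a ≫ f.map x y) := by
  rw [← comp_rmul, nat, comp_lmul]

/-- The identity 2-cell. -/
def id (f : Functor A B) : NatTrans f f where
  app x := eId V (f.obj x)
  naturality x y := (rmul_eId (f.map x y)).trans (lmul_eId (f.map x y)).symm

/-- The vertical composition `(β ∘ α)_x = m ∘ (β_x ⊗ α_x)` of `α : f ⇒ g` and `β : g ⇒ h`. -/
def vcomp {f g h : Functor A B} (α : NatTrans f g) (β : NatTrans g h) : NatTrans f h where
  app x := (λ_ (𝟙_ V)).inv ≫ (β.app x ⊗ₘ α.app x) ≫ eComp V _ _ _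
  naturality x y := by
    change rmul _ (lmul (β.app y) (α.app y)) = lmul (lmul (β.app x) (α.app x)) _
    rw [← rmul_rmul, nat, ← lmul_rmul, nat, lmul_lmul]

/-- The horizontal composition of `β : g ⇒ g'` with the identity of `f`. -/
def whiskerLeft (f : Functor A B) {g g' : Functor B C} (β : NatTrans g g') :
    NatTrans (f.comp g) (f.comp g') where
  app x := β.app (f.obj x)
  naturality x y := β.nat' (f.map x y)

/-- The horizontal composition of `α : f ⇒ f'` with the identity of `g`. -/
def whiskerRight {f f' : Functor A B} (α : NatTrans f f') (g : Functor B C) :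
    NatTrans (f.comp g) (f'.comp g) where
  app x := α.app x ≫ g.map (f'.obj x) (f.obj x)
  naturality x y := by
    change rmul (f'.map x y ≫ g.map _ _) (α.app y ≫ g.map _ _) =
      lmul (α.app x ≫ g.map _ _) (f.map x y ≫ g.map _ _)
    rw [← Functor.rmul_map, ← Functor.lmul_map, nat]

end NatTrans

instance : Quiver (VCat.{w} V) where
  Hom A B := Functor A B

instance homCategory (A B : VCat.{w} V) : Category (A ⟶ B) where
  Hom f g := NatTrans f g
  id f := NatTrans.id f
  comp α β := NatTrans.vcomp α β
  id_comp α := NatTrans.ext <| funext fun x =>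
    (rmul_eq_lmul _ _).symm.trans (rmul_eId (α.app x))
  comp_id α := NatTrans.ext <| funext fun x => lmul_eId (α.app x)
  assoc α β γ := NatTrans.ext <| funext fun x => lmul_lmul (γ.app x) (β.app x) (α.app x)


lemma comp_app {A B : VCat.{w} V} {f g h : A ⟶ B} (α : f ⟶ g) (β : g ⟶ h) (x : A.carrier) :
    NatTrans.app (α ≫ β) x = lmul (β.app x) (α.app x) := rfl

lemma id_app {A B : VCat.{w} V} (f : A ⟶ B) (x : A.carrier) :
    NatTrans.app (𝟙 f) x = eId V (Functor.obj f x) := rfl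

lemma cell_ext {A B : VCat.{w} V} {f g : A ⟶ B} {α β : f ⟶ g}
    (h : ∀ x, NatTrans.app α x = NatTrans.app β x) : α = β := NatTrans.ext (funext h)

/-- The associativity constraint; its components are units. -/
def assocIso {A B C D : VCat.{w} V} (f : Functor A B) (g : Functor B C) (h : Functor C D) :
    @Iso (A ⟶ D) _ ((f.comp g).comp h) (f.comp (g.comp h)) where
  hom :=
    { app x := eId V (h.obj (g.obj (f.obj x)))
      naturality x y := (rmul_eId ((f.comp (g.comp h)).map x y)).trans <|
        (Category.assoc _ _ _).symm.trans (lmul_eId (((f.comp g).comp h).map x y)).symm }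
  inv :=
    { app x := eId V (h.obj (g.obj (f.obj x)))
      naturality x y := (rmul_eId (((f.comp g).comp h).map x y)).trans <|
        (Category.assoc _ _ _).trans (lmul_eId ((f.comp (g.comp h)).map x y)).symm }
  hom_inv_id := cell_ext fun _ => lmul_eId _
  inv_hom_id := cell_ext fun _ => lmul_eId _

/-- The left unit constraint; its components are units. -/
def leftUnitIso {A B : VCat.{w} V} (f : Functor A B) :
    @Iso (A ⟶ B) _ ((Functor.id A).comp f) f where
  hom :=
    { app x := eId V (f.obj x)
      naturality x y := (rmul_eId (f.map x y)).trans <|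
        (Category.id_comp _).symm.trans (lmul_eId (((Functor.id A).comp f).map x y)).symm }
  inv :=
    { app x := eId V (f.obj x)
      naturality x y := (rmul_eId (((Functor.id A).comp f).map x y)).trans <|
        (Category.id_comp _).trans (lmul_eId (f.map x y)).symm }
  hom_inv_id := cell_ext fun _ => lmul_eId _
  inv_hom_id := cell_ext fun _ => lmul_eId _

/-- The right unit constraint; its components are units. -/
def rightUnitIso {A B : VCat.{w} V} (f : Functor A B) :
    @Iso (A ⟶ B) _ (f.comp (Functor.id B)) f where
  hom :=
    { app x := eId V (f.obj x)
      naturality x y := (rmul_eId (f.map x y)).trans <|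
        (Category.comp_id _).symm.trans (lmul_eId ((f.comp (Functor.id B)).map x y)).symm }
  inv :=
    { app x := eId V (f.obj x)
      naturality x y := (rmul_eId ((f.comp (Functor.id B)).map x y)).trans <|
        (Category.comp_id _).trans (lmul_eId (f.map x y)).symm }
  hom_inv_id := cell_ext fun _ => lmul_eId _
  inv_hom_id := cell_ext fun _ => lmul_eId _

/-- The 2-category of `V`-categories, `V`-functors and `V`-natural transformations. -/
instance bicategory : Bicategory (VCat.{w} V) where
  id A := Functor.id A
  comp f g := Functor.comp f g
  homCategory := homCategory
  whiskerLeft f _ _ β := NatTrans.whiskerLeft f β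
  whiskerRight α g := NatTrans.whiskerRight α g
  associator f g h := assocIso f g h
  leftUnitor f := leftUnitIso f
  rightUnitor f := rightUnitIso f
  whiskerLeft_id f g := cell_ext fun x => rfl
  whiskerLeft_comp f _ _ _ α β := cell_ext fun x => rfl
  id_whiskerLeft {A B f g} α := cell_ext fun x => by
    change α.app x = lmul (lmul (eId V _) (α.app x)) (eId V _)
    rw [lmul_pt_eId, lmul_eId]
  comp_whiskerLeft f g h h' α := cell_ext fun x => by
    change α.app _ = lmul (lmul (eId V _) (α.app _)) (eId V _)
    rw [lmul_pt_eId, lmul_eId]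
  id_whiskerRight f g := cell_ext fun x => Functor.eId_map g _
  comp_whiskerRight α β g := cell_ext fun x => Functor.lmul_map g _ _
  whiskerRight_id {A B f g} α := cell_ext fun x => by
    change α.app x ≫ 𝟙 _ = lmul (lmul (eId V _) (α.app x)) (eId V _)
    rw [lmul_pt_eId, lmul_eId, Category.comp_id]
  whiskerRight_comp {A B C D f f'} α g h := cell_ext fun x => by
    change α.app x ≫ g.map _ _ ≫ h.map _ _ =
      lmul (lmul (eId V _) ((α.app x ≫ g.map _ _) ≫ h.map _ _)) (eId V _)
    rw [lmul_pt_eId, lmul_eId, Category.assoc]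
  whisker_assoc f g g' α h := cell_ext fun x => by
    change α.app _ ≫ h.map _ _ = lmul (lmul (eId V _) (α.app _ ≫ h.map _ _)) (eId V _)
    rw [lmul_pt_eId, lmul_eId]
  whisker_exchange {A B C f g h i} α β := cell_ext fun x => by
    change lmul (α.app x ≫ i.map _ _) (β.app (f.obj x)) =
      lmul (β.app (g.obj x)) (α.app x ≫ h.map _ _)
    rw [← NatTrans.nat', rmul_eq_lmul]
  pentagon {A B C D E} f g h i := cell_ext fun x => by
    change lmul (lmul (eId V _) (eId V _)) (eId V _ ≫ i.map _ _) = lmul (eId V _) (eId V _)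
    rw [Functor.eId_map, lmul_eId, lmul_eId]
  triangle {A B C} f g := cell_ext fun x => by
    change lmul (eId V _) (eId V _) = eId V _ ≫ g.map _ _
    rw [Functor.eId_map, lmul_eId]

lemma eqToHom_app {A B : VCat.{w} V} {f g : A ⟶ B} (h : f = g) (x : A.carrier) :
    NatTrans.app (eqToHom h) x = eId V (Functor.obj f x) ≫
      eqToHom (by rw [h]) := by
  subst h
  simp [id_app]

instance : Bicategory.Strict (VCat.{w} V) where
  id_comp {A B} f := Functor.ext (EnrichedFunctor.ext V (fun _ => rfl) (by
    intro x y; exact (Category.comp_id _).trans (Category.id_comp (f.fn.map x y))))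
  comp_id {A B} f := Functor.ext (EnrichedFunctor.ext V (fun _ => rfl) (by
    intro x y; exact (Category.comp_id _).trans (Category.comp_id (f.fn.map x y))))
  assoc {A B C D} f g h := Functor.ext (EnrichedFunctor.ext V (fun _ => rfl) (by
    intro x y; exact (Category.comp_id _).trans (Category.assoc (f.fn.map x y) _ _)))
  leftUnitor_eqToIso f := by
    ext1; apply cell_ext; intro x; rw [eqToIso.hom, eqToHom_app]; exact (Category.comp_id _).symm
  rightUnitor_eqToIso f := by
    ext1; apply cell_ext; intro x; rw [eqToIso.hom, eqToHom_app]; exact (Category.comp_id _).symm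
  associator_eqToIso f g h := by
    ext1; apply cell_ext; intro x; rw [eqToIso.hom, eqToHom_app]; exact (Category.comp_id _).symm

end VCat

/-- A dual `V`-category: a type `carrier` of objects, objects `C_{x,y} = hom x y` of `V`,
comultiplications `Δ_{x,y,z} : C_{x,z} ⟶ C_{x,y} ⊗ C_{y,z}` and counits `ε_x : C_{x,x} ⟶ 𝟙`. -/
structure DualVCat (V : Type u) [Category.{v} V] [MonoidalCategory V] where
  /-- The objects. -/
  carrier : Type w
  /-- The object `C_{x,y}` of `V`. -/
  hom (x y : carrier) : V
  /-- The comultiplication. -/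
  comul (x y z : carrier) : hom x z ⟶ hom x y ⊗ hom y z
  /-- The counit. -/
  counit (x : carrier) : hom x x ⟶ 𝟙_ V
  coassoc (x y z t : carrier) :
    comul x z t ≫ comul x y z ▷ hom z t ≫ (α_ _ _ _).hom = comul x y t ≫ hom x y ◁ comul y z t
  counit_comul (x y : carrier) : comul x x y ≫ counit x ▷ hom x y ≫ (λ_ _).hom = 𝟙 (hom x y)
  comul_counit (x y : carrier) : comul x y y ≫ hom x y ◁ counit y ≫ (ρ_ _).hom = 𝟙 (hom x y)

namespace DualVCat

variable {V : Type u} [Category.{v} V] [MonoidalCategory V]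

/-- For `p : C_{x,y} ⟶ 𝟙` and `a : C_{y,z} ⟶ X`, the composite `(p ⊗ a) ∘ Δ`. -/
def lmul {C : DualVCat.{w} V} {X : V} {x y z : C.carrier} (p : C.hom x y ⟶ 𝟙_ V)
    (a : C.hom y z ⟶ X) : C.hom x z ⟶ X :=
  C.comul x y z ≫ (p ⊗ₘ a) ≫ (λ_ X).hom

/-- For `a : C_{x,y} ⟶ X` and `p : C_{y,z} ⟶ 𝟙`, the composite `(a ⊗ p) ∘ Δ`. -/
def rmul {C : DualVCat.{w} V} {X : V} {x y z : C.carrier} (a : C.hom x y ⟶ X)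
    (p : C.hom y z ⟶ 𝟙_ V) : C.hom x z ⟶ X :=
  C.comul x y z ≫ (a ⊗ₘ p) ≫ (ρ_ X).hom

section calculus

variable {C : DualVCat.{w} V} {X Y : V} {x y z t : C.carrier}

lemma lmul_comp (p : C.hom x y ⟶ 𝟙_ V) (a : C.hom y z ⟶ X) (f : X ⟶ Y) :
    lmul p a ≫ f = lmul p (a ≫ f) := by
  simp only [lmul, MonoidalCategory.tensorHom_def, ← leftUnitor_naturality,
    MonoidalCategory.whiskerLeft_comp, Category.assoc]

lemma rmul_comp (a : C.hom x y ⟶ X) (p : C.hom y z ⟶ 𝟙_ V) (f : X ⟶ Y) :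
    rmul a p ≫ f = rmul (a ≫ f) p := by
  simp only [rmul, MonoidalCategory.tensorHom_def', ← rightUnitor_naturality,
    MonoidalCategory.comp_whiskerRight, Category.assoc]

lemma rmul_eq_lmul (p : C.hom x y ⟶ 𝟙_ V) (q : C.hom y z ⟶ 𝟙_ V) : rmul p q = lmul p q := by
  simp [rmul, lmul, unitors_equal]

lemma lmul_counit (a : C.hom x y ⟶ X) : lmul (C.counit x) a = a := by
  have := C.counit_comul x y
  simp only [lmul, MonoidalCategory.tensorHom_def, Category.assoc, leftUnitor_naturality]
  simpa only [Category.assoc, Category.id_comp] using this =≫ a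

lemma rmul_counit (a : C.hom x y ⟶ X) : rmul a (C.counit y) = a := by
  have := C.comul_counit x y
  simp only [rmul, MonoidalCategory.tensorHom_def', Category.assoc, rightUnitor_naturality]
  simpa only [Category.assoc, Category.id_comp] using this =≫ a

lemma comul_assoc {X Y Z : V} (a : C.hom x y ⟶ X) (b : C.hom y z ⟶ Y) (c : C.hom z t ⟶ Z) :
    C.comul x y t ≫ (a ⊗ₘ (C.comul y z t ≫ (b ⊗ₘ c))) =
      C.comul x z t ≫ ((C.comul x y z ≫ (a ⊗ₘ b)) ⊗ₘ c) ≫ (α_ X Y Z).hom := by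
  have := C.coassoc x y z t
  calc _ = (C.comul x y t ≫ C.hom x y ◁ C.comul y z t) ≫ (a ⊗ₘ (b ⊗ₘ c)) := by
          simp [MonoidalCategory.tensorHom_def']
    _ = C.comul x z t ≫ C.comul x y z ▷ C.hom z t ≫ ((a ⊗ₘ b) ⊗ₘ c) ≫ (α_ _ _ _).hom := by
          rw [← this]
          simp only [Category.assoc, associator_naturality]
    _ = _ := by
          simp [MonoidalCategory.tensorHom_def]

lemma lmul_lmul (p : C.hom x y ⟶ 𝟙_ V) (q : C.hom y z ⟶ 𝟙_ V) (a : C.hom z t ⟶ X) :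
    lmul p (lmul q a) = lmul (lmul p q) a := by
  have := comul_assoc p q a
  have h1 : lmul p (lmul q a) = (C.comul x y t ≫ (p ⊗ₘ (C.comul y z t ≫ (q ⊗ₘ a)))) ≫
      𝟙_ V ◁ (λ_ X).hom ≫ (λ_ X).hom := by
    simp only [lmul, Category.assoc]
    rw [← id_tensorHom, MonoidalCategory.tensorHom_comp_tensorHom_assoc]
    simp only [Category.assoc, Category.comp_id]
  have h2 : lmul (lmul p q) a = C.comul x z t ≫ ((C.comul x y z ≫ (p ⊗ₘ q)) ⊗ₘ a) ≫
      (λ_ (𝟙_ V)).hom ▷ X ≫ (λ_ X).hom := by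
    simp only [lmul]
    rw [← tensorHom_id, MonoidalCategory.tensorHom_comp_tensorHom_assoc]
    simp only [Category.assoc, Category.comp_id]
  rw [h1, h2, this]
  simp only [Category.assoc]
  congr 2
  monoidal

lemma lmul_rmul (p : C.hom x y ⟶ 𝟙_ V) (a : C.hom y z ⟶ X) (q : C.hom z t ⟶ 𝟙_ V) :
    lmul p (rmul a q) = rmul (lmul p a) q := by
  have := comul_assoc p a q
  have h1 : lmul p (rmul a q) = (C.comul x y t ≫ (p ⊗ₘ (C.comul y z t ≫ (a ⊗ₘ q)))) ≫
      𝟙_ V ◁ (ρ_ X).hom ≫ (λ_ X).hom := by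
    simp only [lmul, rmul, Category.assoc]
    rw [← id_tensorHom, MonoidalCategory.tensorHom_comp_tensorHom_assoc]
    simp only [Category.assoc, Category.comp_id]
  have h2 : rmul (lmul p a) q = C.comul x z t ≫ ((C.comul x y z ≫ (p ⊗ₘ a)) ⊗ₘ q) ≫
      (λ_ X).hom ▷ 𝟙_ V ≫ (ρ_ X).hom := by
    simp only [lmul, rmul]
    rw [← tensorHom_id, MonoidalCategory.tensorHom_comp_tensorHom_assoc]
    simp only [Category.assoc, Category.comp_id]
  rw [h1, h2, this]
  simp only [Category.assoc]
  congr 2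
  monoidal

lemma rmul_rmul (a : C.hom x y ⟶ X) (p : C.hom y z ⟶ 𝟙_ V) (q : C.hom z t ⟶ 𝟙_ V) :
    rmul (rmul a p) q = rmul a (lmul p q) := by
  have := comul_assoc a p q
  have h1 : rmul a (lmul p q) = (C.comul x y t ≫ (a ⊗ₘ (C.comul y z t ≫ (p ⊗ₘ q)))) ≫
      X ◁ (λ_ (𝟙_ V)).hom ≫ (ρ_ X).hom := by
    simp only [lmul, rmul, Category.assoc]
    rw [← id_tensorHom, MonoidalCategory.tensorHom_comp_tensorHom_assoc]
    simp only [Category.assoc, Category.comp_id]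
  have h2 : rmul (rmul a p) q = C.comul x z t ≫ ((C.comul x y z ≫ (a ⊗ₘ p)) ⊗ₘ q) ≫
      (ρ_ X).hom ▷ 𝟙_ V ≫ (ρ_ X).hom := by
    simp only [rmul]
    rw [← tensorHom_id, MonoidalCategory.tensorHom_comp_tensorHom_assoc]
    simp only [Category.assoc, Category.comp_id]
  rw [h1, h2, this]
  simp only [Category.assoc]
  congr 2
  monoidal

lemma lmul_pt_counit (p : C.hom x y ⟶ 𝟙_ V) : lmul p (C.counit y) = p := by
  rw [← rmul_eq_lmul, rmul_counit]

end calculus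

/-- A dual `V`-functor `f : C → D`: a map `f` on objects together with morphisms
`f_{x,y} : D_{f x, f y} ⟶ C_{x,y}` compatible with comultiplications and counits. -/
structure Functor (C D : DualVCat.{w} V) where
  /-- The map on objects. -/
  obj : C.carrier → D.carrier
  /-- The morphism `f_{x,y}`. -/
  map (x y : C.carrier) : D.hom (obj x) (obj y) ⟶ C.hom x y
  map_comul (x y z : C.carrier) :
    D.comul (obj x) (obj y) (obj z) ≫ (map x y ⊗ₘ map y z) = map x z ≫ C.comul x y z
  map_counit (x : C.carrier) : D.counit (obj x) = map x x ≫ C.counit x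

namespace Functor

/-- The identity dual `V`-functor. -/
def id (C : DualVCat.{w} V) : Functor C C where
  obj x := x
  map _ _ := 𝟙 _
  map_comul := by simp
  map_counit := by simp

/-- The composition of dual `V`-functors, in diagrammatic order: the morphisms are
`f_{x,y} ∘ g_{f x, f y}`. -/
def comp {C D E : DualVCat.{w} V} (f : Functor C D) (g : Functor D E) : Functor C E where
  obj x := g.obj (f.obj x)
  map x y := g.map (f.obj x) (f.obj y) ≫ f.map x y
  map_comul x y z := by
    rw [Category.assoc, ← f.map_comul, ← Category.assoc, ← g.map_comul, Category.assoc,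
      MonoidalCategory.tensorHom_comp_tensorHom]
  map_counit x := by
    rw [g.map_counit, f.map_counit, Category.assoc]

variable {C D : DualVCat.{w} V} {X : V} {x y z : C.carrier} (f : Functor C D)

lemma map_lmul (p : C.hom x y ⟶ 𝟙_ V) (a : C.hom y z ⟶ X) :
    f.map x z ≫ lmul p a = lmul (f.map x y ≫ p) (f.map y z ≫ a) := by
  simp only [lmul]
  rw [← Category.assoc, ← f.map_comul, Category.assoc,
    MonoidalCategory.tensorHom_comp_tensorHom_assoc]

lemma map_rmul (a : C.hom x y ⟶ X) (p : C.hom y z ⟶ 𝟙_ V) :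
    f.map x z ≫ rmul a p = rmul (f.map x y ≫ a) (f.map y z ≫ p) := by
  simp only [rmul]
  rw [← Category.assoc, ← f.map_comul, Category.assoc,
    MonoidalCategory.tensorHom_comp_tensorHom_assoc]

lemma ext' {f g : Functor C D} (h_obj : ∀ x, f.obj x = g.obj x)
    (h_map : ∀ x y, f.map x y = eqToHom (by rw [h_obj, h_obj]) ≫ g.map x y) : f = g := by
  match f, g with
  | mk f_obj f_map _ _, mk g_obj g_map _ _ =>
    obtain rfl : f_obj = g_obj := funext fun x => h_obj x
    congr
    ext x y
    simpa using h_map x y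

end Functor

/-- A dual `V`-natural transformation `f ⇒ g`: morphisms `α_x : D_{f x, g x} ⟶ 𝟙` with
`(f_{x,y} ⊗ α_y) ∘ Δ = (α_x ⊗ g_{x,y}) ∘ Δ` on `D_{f x, g y}`. -/
@[ext]
structure NatTrans {C D : DualVCat.{w} V} (f g : Functor C D) where
  /-- The components. -/
  app (x : C.carrier) : D.hom (f.obj x) (g.obj x) ⟶ 𝟙_ V
  naturality (x y : C.carrier) :
    D.comul _ _ _ ≫ (f.map x y ⊗ₘ app y) ≫ (ρ_ (C.hom x y)).hom =
      D.comul _ _ _ ≫ (app x ⊗ₘ g.map x y) ≫ (λ_ (C.hom x y)).hom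

namespace NatTrans

variable {C D E : DualVCat.{w} V}

lemma nat {f g : Functor C D} (α : NatTrans f g) (x y : C.carrier) :
    rmul (f.map x y) (α.app y) = lmul (α.app x) (g.map x y) := α.naturality x y

lemma nat' {f g : Functor C D} (α : NatTrans f g) {X : V} {x y : C.carrier} (a : C.hom x y ⟶ X) :
    rmul (f.map x y ≫ a) (α.app y) = lmul (α.app x) (g.map x y ≫ a) := by
  rw [← rmul_comp, nat, lmul_comp]

/-- The identity 2-cell. -/
def id (f : Functor C D) : NatTrans f f where
  app x := D.counit (f.obj x)
  naturality x y := (rmul_counit (f.map x y)).trans (lmul_counit (f.map x y)).symm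

/-- The vertical composition `(β ∘ α)_x = (α_x ⊗ β_x) ∘ Δ` of `α : f ⇒ g` and `β : g ⇒ h`. -/
def vcomp {f g h : Functor C D} (α : NatTrans f g) (β : NatTrans g h) : NatTrans f h where
  app x := D.comul _ _ _ ≫ (α.app x ⊗ₘ β.app x) ≫ (λ_ (𝟙_ V)).hom
  naturality x y := by
    change rmul _ (lmul (α.app y) (β.app y)) = lmul (lmul (α.app x) (β.app x)) _
    rw [← rmul_rmul, nat, ← lmul_rmul, nat, lmul_lmul]

/-- The horizontal composition of `β : g ⇒ g'` with the identity of `f`. -/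
def whiskerLeft (f : Functor C D) {g g' : Functor D E} (β : NatTrans g g') :
    NatTrans (f.comp g) (f.comp g') where
  app x := β.app (f.obj x)
  naturality x y := β.nat' (f.map x y)

/-- The horizontal composition of `α : f ⇒ f'` with the identity of `g`. -/
def whiskerRight {f f' : Functor C D} (α : NatTrans f f') (g : Functor D E) :
    NatTrans (f.comp g) (f'.comp g) where
  app x := g.map (f.obj x) (f'.obj x) ≫ α.app x
  naturality x y := by
    change rmul (g.map _ _ ≫ f.map x y) (g.map _ _ ≫ α.app y) =
      lmul (g.map _ _ ≫ α.app x) (g.map _ _ ≫ f'.map x y)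
    rw [← Functor.map_rmul, ← Functor.map_lmul, nat]

end NatTrans

instance : Quiver (DualVCat.{w} V) where
  Hom C D := Functor C D

instance homCategory (C D : DualVCat.{w} V) : Category (C ⟶ D) where
  Hom f g := NatTrans f g
  id f := NatTrans.id f
  comp α β := NatTrans.vcomp α β
  id_comp α := NatTrans.ext <| funext fun x => lmul_counit (α.app x)
  comp_id α := NatTrans.ext <| funext fun x => lmul_pt_counit (α.app x)
  assoc α β γ := NatTrans.ext <| funext fun x => (lmul_lmul (α.app x) (β.app x) (γ.app x)).symm

lemma comp_app {C D : DualVCat.{w} V} {f g h : C ⟶ D} (α : f ⟶ g) (β : g ⟶ h) (x : C.carrier) :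
    NatTrans.app (α ≫ β) x = lmul (α.app x) (β.app x) := rfl

lemma id_app {C D : DualVCat.{w} V} (f : C ⟶ D) (x : C.carrier) :
    NatTrans.app (𝟙 f) x = D.counit (Functor.obj f x) := rfl

lemma cell_ext {C D : DualVCat.{w} V} {f g : C ⟶ D} {α β : f ⟶ g}
    (h : ∀ x, NatTrans.app α x = NatTrans.app β x) : α = β := NatTrans.ext (funext h)

/-- The associativity constraint; its components are counits. -/
def assocIso {A B C D : DualVCat.{w} V} (f : Functor A B) (g : Functor B C) (h : Functor C D) :
    @Iso (A ⟶ D) _ ((f.comp g).comp h) (f.comp (g.comp h)) where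
  hom :=
    { app x := D.counit (h.obj (g.obj (f.obj x)))
      naturality x y := (rmul_counit (((f.comp g).comp h).map x y)).trans <|
        (Category.assoc _ _ _).symm.trans (lmul_counit ((f.comp (g.comp h)).map x y)).symm }
  inv :=
    { app x := D.counit (h.obj (g.obj (f.obj x)))
      naturality x y := (rmul_counit ((f.comp (g.comp h)).map x y)).trans <|
        (Category.assoc _ _ _).trans (lmul_counit (((f.comp g).comp h).map x y)).symm }
  hom_inv_id := cell_ext fun _ => lmul_counit _
  inv_hom_id := cell_ext fun _ => lmul_counit _

/-- The left unit constraint; its components are counits. -/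
def leftUnitIso {C D : DualVCat.{w} V} (f : Functor C D) :
    @Iso (C ⟶ D) _ ((Functor.id C).comp f) f where
  hom :=
    { app x := D.counit (f.obj x)
      naturality x y := (rmul_counit (((Functor.id C).comp f).map x y)).trans <|
        (Category.comp_id _).trans (lmul_counit (f.map x y)).symm }
  inv :=
    { app x := D.counit (f.obj x)
      naturality x y := (rmul_counit (f.map x y)).trans <|
        (Category.comp_id _).symm.trans (lmul_counit (((Functor.id C).comp f).map x y)).symm }
  hom_inv_id := cell_ext fun _ => lmul_counit _
  inv_hom_id := cell_ext fun _ => lmul_counit _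

/-- The right unit constraint; its components are counits. -/
def rightUnitIso {C D : DualVCat.{w} V} (f : Functor C D) :
    @Iso (C ⟶ D) _ (f.comp (Functor.id D)) f where
  hom :=
    { app x := D.counit (f.obj x)
      naturality x y := (rmul_counit ((f.comp (Functor.id D)).map x y)).trans <|
        (Category.id_comp _).trans (lmul_counit (f.map x y)).symm }
  inv :=
    { app x := D.counit (f.obj x)
      naturality x y := (rmul_counit (f.map x y)).trans <|
        (Category.id_comp _).symm.trans (lmul_counit ((f.comp (Functor.id D)).map x y)).symm }
  hom_inv_id := cell_ext fun _ => lmul_counit _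
  inv_hom_id := cell_ext fun _ => lmul_counit _

/-- The 2-category of dual `V`-categories, dual `V`-functors and dual `V`-natural
transformations. -/
instance bicategory : Bicategory (DualVCat.{w} V) where
  id A := Functor.id A
  comp f g := Functor.comp f g
  homCategory := homCategory
  whiskerLeft f _ _ β := NatTrans.whiskerLeft f β
  whiskerRight α g := NatTrans.whiskerRight α g
  associator f g h := assocIso f g h
  leftUnitor f := leftUnitIso f
  rightUnitor f := rightUnitIso f
  whiskerLeft_id f g := cell_ext fun x => rfl
  whiskerLeft_comp f _ _ _ α β := cell_ext fun x => rfl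
  id_whiskerLeft {C D f g} α := cell_ext fun x => by
    change α.app x = lmul (D.counit _) (lmul (α.app x) (D.counit _))
    rw [lmul_pt_counit, lmul_counit]
  comp_whiskerLeft {A B C D} f g h h' α := cell_ext fun x => by
    change α.app _ = lmul (D.counit _) (lmul (α.app _) (D.counit _))
    rw [lmul_pt_counit, lmul_counit]
  id_whiskerRight {C D E} f g := cell_ext fun x => (Functor.map_counit g _).symm
  comp_whiskerRight α β g := cell_ext fun x => Functor.map_lmul g _ _
  whiskerRight_id {C D f g} α := cell_ext fun x => by
    change 𝟙 _ ≫ α.app x = lmul (D.counit _) (lmul (α.app x) (D.counit _))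
    rw [lmul_pt_counit, lmul_counit, Category.id_comp]
  whiskerRight_comp {A B C D f f'} α g h := cell_ext fun x => by
    change (h.map _ _ ≫ g.map _ _) ≫ α.app x =
      lmul (D.counit _) (lmul (h.map _ _ ≫ g.map _ _ ≫ α.app x) (D.counit _))
    rw [lmul_pt_counit, lmul_counit, Category.assoc]
  whisker_assoc {A B C D} f g g' α h := cell_ext fun x => by
    change h.map _ _ ≫ α.app _ = lmul (D.counit _) (lmul (h.map _ _ ≫ α.app _) (D.counit _))
    rw [lmul_pt_counit, lmul_counit]
  whisker_exchange {A B C f g h i} α β := cell_ext fun x => by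
    change lmul (β.app (f.obj x)) (i.map _ _ ≫ α.app x) =
      lmul (h.map _ _ ≫ α.app x) (β.app (g.obj x))
    rw [← NatTrans.nat', rmul_eq_lmul]
  pentagon {A B C D E} f g h i := cell_ext fun x => by
    change lmul (i.map _ _ ≫ D.counit _) (lmul (E.counit _) (E.counit _)) =
      lmul (E.counit _) (E.counit _)
    rw [← Functor.map_counit, lmul_counit, lmul_counit]
  triangle {A B C} f g := cell_ext fun x => by
    change lmul (C.counit _) (C.counit _) = g.map _ _ ≫ B.counit _
    rw [← Functor.map_counit, lmul_counit]

lemma eqToHom_app {C D : DualVCat.{w} V} {f g : C ⟶ D} (h : f = g) (x : C.carrier) :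
    NatTrans.app (eqToHom h) x = eqToHom (by rw [h]) ≫ D.counit (Functor.obj f x) := by
  subst h
  simp [id_app]

instance : Bicategory.Strict (DualVCat.{w} V) where
  id_comp {A B} f := Functor.ext' (fun _ => rfl) fun x y =>
    (Category.comp_id (f.map x y)).trans (Category.id_comp (f.map x y)).symm
  comp_id {A B} f := Functor.ext' (fun _ => rfl) fun x y => rfl
  assoc {A B C D} f g h := Functor.ext' (fun _ => rfl) fun x y =>
    (Category.assoc _ _ (f.map x y)).symm.trans (Category.id_comp _).symm
  leftUnitor_eqToIso f := by
    ext1; apply cell_ext; intro x; rw [eqToIso.hom, eqToHom_app]; exact (Category.id_comp _).symm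
  rightUnitor_eqToIso f := by
    ext1; apply cell_ext; intro x; rw [eqToIso.hom, eqToHom_app]; exact (Category.id_comp _).symm
  associator_eqToIso f g h := by
    ext1; apply cell_ext; intro x; rw [eqToIso.hom, eqToHom_app]; exact (Category.id_comp _).symm

end DualVCat

open scoped TensorProduct

section dualAlgebra

variable (k : Type u) [CommRing k]

/-- The dual `C^* = Hom_k(C, k)` of a `k`-coalgebra, as a `k`-algebra whose product is the opposite
of the convolution product, `⟨c^* d^*, c⟩ = ⟨c^*, c_(2)⟩ ⟨d^*, c_(1)⟩`, and whose unit is the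
counit of `C`. -/
abbrev DualAlg (C : Type u) [AddCommGroup C] [Module k C] [Coalgebra k C] : Type u :=
  (WithConv (C →ₗ[k] k))ᵐᵒᵖ

variable {k}

namespace DualAlg

variable {C D E : Type u} [AddCommGroup C] [Module k C] [Coalgebra k C]
  [AddCommGroup D] [Module k D] [Coalgebra k D] [AddCommGroup E] [Module k E] [Coalgebra k E]

/-- The linear form underlying an element of the dual algebra. -/
noncomputable def form (φ : DualAlg k C) : C →ₗ[k] k := φ.unop.ofConv

/-- The element of the dual algebra given by a linear form. -/
noncomputable def of (φ : C →ₗ[k] k) : DualAlg k C := MulOpposite.op (WithConv.toConv φ)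

lemma ext_form {φ ψ : DualAlg k C} (h : φ.form = ψ.form) : φ = ψ :=
  MulOpposite.unop_injective (WithConv.ext h)

@[simp] lemma form_of (φ : C →ₗ[k] k) : (of φ).form = φ := rfl
@[simp] lemma of_form (φ : DualAlg k C) : of φ.form = φ := rfl

lemma form_mul (φ ψ : DualAlg k C) (c : C) : (φ * ψ).form c =
    LinearMap.mul' k k (TensorProduct.map ψ.form φ.form (Coalgebra.comul c)) := rfl

lemma form_one : (1 : DualAlg k C).form = Coalgebra.counit := rfl

variable (k C) in
/-- The dual algebra is `Hom_k(C, k)` as a module. -/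
noncomputable def linearEquiv : DualAlg k C ≃ₗ[k] (C →ₗ[k] k) :=
  (MulOpposite.opLinearEquiv k).symm.trans (WithConv.linearEquiv k _)

lemma linearEquiv_apply (φ : DualAlg k C) : linearEquiv k C φ = φ.form := rfl
lemma linearEquiv_symm_apply (φ : C →ₗ[k] k) : (linearEquiv k C).symm φ = of φ := rfl

instance [Module.Finite k C] [Module.Projective k C] : Module.Finite k (DualAlg k C) :=
  Module.Finite.equiv (linearEquiv k C).symm

instance [Module.Finite k C] [Module.Projective k C] : Module.Projective k (DualAlg k C) :=
  Module.Projective.of_equiv (linearEquiv k C).symm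

/-- The algebra morphism dual to a coalgebra morphism. -/
noncomputable def map (f : C →ₗc[k] D) : DualAlg k D →ₐ[k] DualAlg k C :=
  AlgHom.ofLinearMap
    ((linearEquiv k C).symm.toLinearMap ∘ₗ LinearMap.lcomp k k f.toLinearMap ∘ₗ
      (linearEquiv k D).toLinearMap)
    (ext_form (LinearMap.ext fun c => CoalgHomClass.counit_comp_apply f c))
    (fun φ ψ => ext_form (LinearMap.ext fun c => by
      change LinearMap.mul' k k (TensorProduct.map ψ.form φ.form (Coalgebra.comul (f c))) =
        LinearMap.mul' k k (TensorProduct.map (ψ.form ∘ₗ f.toLinearMap)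
          (φ.form ∘ₗ f.toLinearMap) (Coalgebra.comul c))
      rw [← CoalgHomClass.map_comp_comul_apply, TensorProduct.map_map]
      rfl))

lemma map_form (f : C →ₗc[k] D) (φ : DualAlg k D) : (map f φ).form = φ.form ∘ₗ f.toLinearMap := rfl

/-- The counit `φ ↦ φ 1` identifying the dual of `k` with `k`. -/
noncomputable def evalOne : DualAlg k k ≃ₐ[k] k :=
  AlgEquiv.ofLinearEquiv ((linearEquiv k k).trans (LinearMap.ringLmapEquivSelf k k k))
    (by simp [linearEquiv_apply, form_one])
    (fun φ ψ => by
      change (φ * ψ).form 1 = φ.form 1 * ψ.form 1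
      rw [form_mul]
      simp [mul_comm])

lemma evalOne_apply (φ : DualAlg k k) : evalOne φ = φ.form 1 := rfl

variable (C D) in
/-- The isomorphism of modules `ι : D^* ⊗ C^* → (C ⊗ D)^*`,
`⟨ι (d^* ⊗ c^*), c ⊗ d⟩ = ⟨d^*, d⟩ ⟨c^*, c⟩`, for finitely generated projective `C`. -/
noncomputable def iotaLinear [Module.Finite k C] [Module.Projective k C] :
    DualAlg k D ⊗[k] DualAlg k C ≃ₗ[k] DualAlg k (C ⊗[k] D) :=
  (TensorProduct.comm k _ _).trans <|
    (TensorProduct.congr (linearEquiv k C) (linearEquiv k D)).trans <|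
    (dualTensorHomEquiv k C (D →ₗ[k] k)).trans <|
    (TensorProduct.lift.equiv (.id k) C D k).trans (linearEquiv k (C ⊗[k] D)).symm

lemma iotaLinear_tmul [Module.Finite k C] [Module.Projective k C] (φ : DualAlg k D)
    (ψ : DualAlg k C) (c : C) (d : D) :
    (iotaLinear C D (φ ⊗ₜ ψ)).form (c ⊗ₜ d) = φ.form d * ψ.form c := by
  change (ψ.form c • φ.form) d = _
  simp [mul_comm]

lemma ext_tmul {φ ψ : DualAlg k (C ⊗[k] D)} (h : ∀ c d, φ.form (c ⊗ₜ d) = ψ.form (c ⊗ₜ d)) :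
    φ = ψ := ext_form (TensorProduct.ext' h)

variable (C D) in
/-- The isomorphism `ι` is an isomorphism of algebras. -/
noncomputable def iota [Module.Finite k C] [Module.Projective k C] :
    DualAlg k D ⊗[k] DualAlg k C ≃ₐ[k] DualAlg k (C ⊗[k] D) :=
  Algebra.TensorProduct.algEquivOfLinearEquivTensorProduct (iotaLinear C D)
    (fun φ φ' ψ ψ' => ext_tmul fun c d => by
      rw [iotaLinear_tmul, form_mul, form_mul, form_mul, TensorProduct.comul_tmul]
      generalize Coalgebra.comul (R := k) c = s
      generalize Coalgebra.comul (R := k) d = t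
      induction s with
      | zero => simp
      | add s s' hs hs' => simp only [map_add, mul_add, TensorProduct.add_tmul, hs, hs']
      | tmul c c' =>
        induction t with
        | zero => simp
        | add t t' ht ht' => simp only [map_add, add_mul, TensorProduct.tmul_add, ht, ht']
        | tmul d d' =>
          simp only [TensorProduct.map_tmul, LinearMap.mul'_apply,
            TensorProduct.AlgebraTensorModule.tensorTensorTensorComm_tmul, iotaLinear_tmul]
          ring)
    (ext_tmul fun c d => by
      rw [iotaLinear_tmul, form_one, form_one, form_one]
      simp [mul_comm])

lemma iota_tmul [Module.Finite k C] [Module.Projective k C] (φ : DualAlg k D)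
    (ψ : DualAlg k C) (c : C) (d : D) :
    (iota (k := k) C D (φ ⊗ₜ ψ)).form (c ⊗ₜ d) = φ.form d * ψ.form c :=
  iotaLinear_tmul φ ψ c d

end DualAlg
end dualAlgebra

section coalgebrasAndAlgebras

variable (k : Type u) [CommRing k]

/-- The property of `k`-coalgebras: the underlying module is finitely generated and projective. -/
def isFGProjCoalg : ObjectProperty (CoalgCat.{u} k) :=
  fun C => Module.Finite k C ∧ Module.Projective k C

/-- The property of `k`-algebras: the underlying module is finitely generated and projective. -/
def isFGProjAlg : ObjectProperty (AlgCat.{u} k) :=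
  fun A => Module.Finite k A ∧ Module.Projective k A

instance : (isFGProjCoalg k).IsMonoidal where
  prop_unit := ⟨inferInstanceAs (Module.Finite k k), inferInstanceAs (Module.Projective k k)⟩
  prop_tensor C D hC hD := by
    have := hC.1; have := hC.2; have := hD.1; have := hD.2
    exact ⟨inferInstanceAs (Module.Finite k (C ⊗[k] D)),
      inferInstanceAs (Module.Projective k (C ⊗[k] D))⟩

instance : (isFGProjAlg k).IsMonoidal where
  prop_unit := ⟨inferInstanceAs (Module.Finite k k), inferInstanceAs (Module.Projective k k)⟩
  prop_tensor A B hA hB := by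
    have := hA.1; have := hA.2; have := hB.1; have := hB.2
    exact ⟨inferInstanceAs (Module.Finite k (A ⊗[k] B)),
      inferInstanceAs (Module.Projective k (A ⊗[k] B))⟩

/-- The monoidal category of coalgebras in the category of finitely generated projective
`k`-modules, with coalgebra morphisms. -/
abbrev FGProjCoalg : Type (u + 1) := (isFGProjCoalg k).FullSubcategory

/-- The monoidal category of algebras in the category of finitely generated projective
`k`-modules, with algebra morphisms. -/
abbrev FGProjAlg : Type (u + 1) := (isFGProjAlg k).FullSubcategory

end coalgebrasAndAlgebras

namespace FGProjCoalg

variable {k : Type u} [CommRing k]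

instance (C : FGProjCoalg k) : Module.Finite k C.obj := C.property.1
instance (C : FGProjCoalg k) : Module.Projective k C.obj := C.property.2

/-- The dual algebra of a finitely generated projective coalgebra. -/
noncomputable def dual (C : FGProjCoalg k) : FGProjAlg k :=
  ⟨AlgCat.of k (DualAlg k C.obj), inferInstanceAs (Module.Finite k (DualAlg k C.obj)),
    inferInstanceAs (Module.Projective k (DualAlg k C.obj))⟩

/-- The algebra morphism `f^* : D^* ⟶ C^*` dual to a coalgebra morphism `f : C ⟶ D`. -/
noncomputable def dualMap {C D : FGProjCoalg k} (f : C ⟶ D) : dual D ⟶ dual C :=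
  ObjectProperty.homMk (AlgCat.ofHom (DualAlg.map f.hom.toCoalgHom))

lemma hom_ext_alg {A B : FGProjAlg k} {f g : A ⟶ B} (h : ∀ a : A.obj, f.hom.hom a = g.hom.hom a) :
    f = g := by
  apply ObjectProperty.hom_ext
  apply AlgCat.hom_ext
  exact AlgHom.ext h

lemma dualMap_id (C : FGProjCoalg k) : dualMap (𝟙 C) = 𝟙 (dual C) := rfl

lemma dualMap_comp {C D E : FGProjCoalg k} (f : C ⟶ D) (g : D ⟶ E) :
    dualMap (f ≫ g) = dualMap g ≫ dualMap f := rfl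

/-- The isomorphism of algebras `ι : D^* ⊗ C^* ≅ (C ⊗ D)^*`. -/
noncomputable def dualTensor (C D : FGProjCoalg k) : dual D ⊗ dual C ≅ dual (C ⊗ D) :=
  (isFGProjAlg k).isoMk (DualAlg.iota (k := k) C.obj D.obj).toAlgebraIso

/-- The isomorphism of algebras `k^* ≅ k`. -/
noncomputable def dualUnit : dual (𝟙_ (FGProjCoalg k)) ≅ 𝟙_ (FGProjAlg k) :=
  (isFGProjAlg k).isoMk (DualAlg.evalOne (k := k)).toAlgebraIso

lemma hom_ext_tensor {A B X : FGProjAlg k} {f g : A ⊗ B ⟶ X}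
    (h : ∀ (a : A.obj) (b : B.obj), f.hom.hom (a ⊗ₜ[k] b) = g.hom.hom (a ⊗ₜ[k] b)) : f = g := by
  apply ObjectProperty.hom_ext
  apply AlgCat.hom_ext
  exact Algebra.TensorProduct.ext' h

lemma dualTensor_natural {C C' D D' : FGProjCoalg k} (f : C ⟶ C') (g : D ⟶ D') :
    (dualMap g ⊗ₘ dualMap f) ≫ (dualTensor C D).hom =
      (dualTensor C' D').hom ≫ dualMap (f ⊗ₘ g) := by
  apply hom_ext_tensor
  intro (φ : DualAlg k D'.obj) (ψ : DualAlg k C'.obj)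
  apply DualAlg.ext_tmul
  intro c d
  change (DualAlg.iota (k := k) C.obj D.obj (DualAlg.map g.hom.toCoalgHom φ ⊗ₜ
    DualAlg.map f.hom.toCoalgHom ψ)).form (c ⊗ₜ d) =
    (DualAlg.iota (k := k) C'.obj D'.obj (φ ⊗ₜ ψ)).form
      (f.hom.toCoalgHom c ⊗ₜ g.hom.toCoalgHom d)
  rw [DualAlg.iota_tmul, DualAlg.iota_tmul]
  rfl

lemma dualTensor_assoc (C D E : FGProjCoalg k) :
    (α_ (dual E) (dual D) (dual C)).hom ≫ dual E ◁ (dualTensor C D).hom ≫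
        (dualTensor (C ⊗ D) E).hom ≫ dualMap (α_ C D E).inv =
      (dualTensor D E).hom ▷ dual C ≫ (dualTensor C (D ⊗ E)).hom := by
  apply ObjectProperty.hom_ext
  apply AlgCat.hom_ext
  apply AlgHom.toLinearMap_injective
  apply TensorProduct.ext_threefold
  intro (χ : DualAlg k E.obj) (φ : DualAlg k D.obj) (ψ : DualAlg k C.obj)
  apply DualAlg.ext_tmul (C := C.obj) (D := D.obj ⊗[k] E.obj)
  intro c t
  induction t with
  | zero => rw [TensorProduct.tmul_zero, map_zero, map_zero]
  | add t t' ht ht' => rw [TensorProduct.tmul_add, map_add, map_add, ht, ht']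
  | tmul d e =>
    change (DualAlg.iota (k := k) (C.obj ⊗[k] D.obj) E.obj
      (χ ⊗ₜ DualAlg.iota (k := k) C.obj D.obj (φ ⊗ₜ ψ))).form ((c ⊗ₜ d) ⊗ₜ e) =
      (DualAlg.iota (k := k) C.obj (D.obj ⊗[k] E.obj)
      (DualAlg.iota (k := k) D.obj E.obj (χ ⊗ₜ φ) ⊗ₜ ψ)).form (c ⊗ₜ (d ⊗ₜ e))
    rw [DualAlg.iota_tmul, DualAlg.iota_tmul, DualAlg.iota_tmul, DualAlg.iota_tmul, mul_assoc]

lemma dualUnit_left (C : FGProjCoalg k) :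
    dualUnit.hom ▷ dual C ≫ (λ_ (dual C)).hom =
      (dualTensor C (𝟙_ _)).hom ≫ dualMap (ρ_ C).inv := by
  apply hom_ext_tensor
  intro (φ : DualAlg k k) (ψ : DualAlg k C.obj)
  apply DualAlg.ext_form
  apply LinearMap.ext
  intro c
  change (φ.form 1 • ψ).form c = (DualAlg.iota (k := k) C.obj k (φ ⊗ₜ ψ)).form (c ⊗ₜ 1)
  rw [DualAlg.iota_tmul]
  rfl

lemma dualUnit_right (C : FGProjCoalg k) :
    dual C ◁ dualUnit.hom ≫ (ρ_ (dual C)).hom =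
      (dualTensor (𝟙_ _) C).hom ≫ dualMap (λ_ C).inv := by
  apply hom_ext_tensor
  intro (φ : DualAlg k C.obj) (ψ : DualAlg k k)
  apply DualAlg.ext_form
  apply LinearMap.ext
  intro c
  change (ψ.form 1 • φ).form c = (DualAlg.iota (k := k) k C.obj (φ ⊗ₜ ψ)).form (1 ⊗ₜ c)
  rw [DualAlg.iota_tmul]
  exact mul_comm _ _

end FGProjCoalg

namespace Duality

variable {k : Type u} [CommRing k]

open FGProjCoalg

/-- The dual category of a category `A` enriched in finitely generated projective coalgebras: it
has the same objects, `C_{x,y} = (A_{y,x})^*`, the comultiplication is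
`ι⁻¹ ∘ m^* : (A_{z,x})^* ⟶ (A_{z,y} ⊗ A_{y,x})^* ≅ (A_{y,x})^* ⊗ (A_{z,y})^*`
and the counit is `η^* : (A_{x,x})^* ⟶ k^* ≅ k`. -/
noncomputable abbrev obj (A : VCat.{w} (FGProjCoalg k)) : DualVCat.{w} (FGProjAlg k) where
  carrier := A.carrier
  hom x y := dual (A.hom y x)
  comul x y z := dualMap (eComp _ z y x) ≫ (dualTensor (A.hom z y) (A.hom y x)).inv
  counit x := dualMap (eId _ x) ≫ dualUnit.hom
  coassoc x y z t := by
    have h := congrArg dualMap (e_assoc' (FGProjCoalg k) t z y x)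
    have h1 := dualTensor_natural (eComp (FGProjCoalg k) t z y) (𝟙 (A.hom y x))
    have h2 := dualTensor_natural (𝟙 (A.hom t z)) (eComp (FGProjCoalg k) z y x)
    have h3 := dualTensor_assoc (A.hom t z) (A.hom z y) (A.hom y x)
    rw [dualMap_id, tensorHom_id, id_tensorHom] at h1 h2
    simp only [dualMap_comp, Category.assoc] at h
    have h4 : dualMap (α_ (A.hom t z) (A.hom z y) (A.hom y x)).inv ≫
        dualMap (α_ (A.hom t z) (A.hom z y) (A.hom y x)).hom = 𝟙 _ := by
      rw [← dualMap_comp, Iso.hom_inv_id, dualMap_id]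
    have h5 : dualMap (α_ (A.hom t z) (A.hom z y) (A.hom y x)).hom ≫
        (dualTensor (A.hom t z ⊗ A.hom z y) (A.hom y x)).inv ≫
        dual (A.hom y x) ◁ (dualTensor (A.hom t z) (A.hom z y)).inv =
        (dualTensor (A.hom t z) (A.hom z y ⊗ A.hom y x)).inv ≫
        (dualTensor (A.hom z y) (A.hom y x)).inv ▷ dual (A.hom t z) ≫ (α_ _ _ _).hom := by
      rw [← cancel_epi ((dualTensor (A.hom z y) (A.hom y x)).hom ▷ dual (A.hom t z) ≫
        (dualTensor (A.hom t z) (A.hom z y ⊗ A.hom y x)).hom)]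
      conv_lhs => rw [← h3]
      simp only [Category.assoc, reassoc_of% h4, Iso.hom_inv_id_assoc,
        whiskerLeft_hom_inv, hom_inv_whiskerRight_assoc, Category.comp_id]
    rw [MonoidalCategory.comp_whiskerRight, MonoidalCategory.whiskerLeft_comp]
    simp only [Category.assoc]
    have h6 : (dualTensor (A.hom t z) (A.hom z x)).inv ≫
        dualMap (eComp (FGProjCoalg k) z y x) ▷ dual (A.hom t z) =
        dualMap (A.hom t z ◁ eComp (FGProjCoalg k) z y x) ≫
        (dualTensor (A.hom t z) (A.hom z y ⊗ A.hom y x)).inv := by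
      rw [Iso.inv_comp_eq, ← Category.assoc, Iso.eq_comp_inv]
      exact h2
    have h7 : (dualTensor (A.hom t y) (A.hom y x)).inv ≫
        dual (A.hom y x) ◁ dualMap (eComp (FGProjCoalg k) t z y) =
        dualMap (eComp (FGProjCoalg k) t z y ▷ A.hom y x) ≫
        (dualTensor (A.hom t z ⊗ A.hom z y) (A.hom y x)).inv := by
      rw [Iso.inv_comp_eq, ← Category.assoc, Iso.eq_comp_inv]
      exact h1
    rw [reassoc_of% h6, reassoc_of% h7, ← reassoc_of% h, h5]
  counit_comul x y := by
    have h := congrArg dualMap (e_comp_id (FGProjCoalg k) y x)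
    have h1 := dualTensor_natural (𝟙 (A.hom y x)) (eId (FGProjCoalg k) x)
    have h2 := dualUnit_left (A.hom y x)
    rw [dualMap_id, tensorHom_id, id_tensorHom] at h1
    rw [MonoidalCategory.comp_whiskerRight, Category.assoc, Category.assoc, h2,
      reassoc_of% h1, Iso.inv_hom_id_assoc]
    simp only [dualMap_comp, Category.assoc] at h
    exact h
  comul_counit x y := by
    have h := congrArg dualMap (e_id_comp (FGProjCoalg k) y x)
    have h1 := dualTensor_natural (eId (FGProjCoalg k) y) (𝟙 (A.hom y x))
    have h2 := dualUnit_right (A.hom y x)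
    rw [dualMap_id, tensorHom_id, id_tensorHom] at h1
    rw [MonoidalCategory.whiskerLeft_comp, Category.assoc, Category.assoc, h2,
      reassoc_of% h1, Iso.inv_hom_id_assoc]
    simp only [dualMap_comp, Category.assoc] at h
    exact h

lemma dualMap_mul {A : VCat.{w} (FGProjCoalg k)} {x y z : A.carrier} {X Y : FGProjCoalg k}
    (p : X ⟶ A.hom x y) (q : Y ⟶ A.hom y z) :
    dualMap ((p ⊗ₘ q) ≫ eComp _ x y z) =
      (dualMap (eComp _ x y z) ≫ (dualTensor (A.hom x y) (A.hom y z)).inv) ≫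
        (dualMap q ⊗ₘ dualMap p) ≫ (dualTensor X Y).hom := by
  rw [dualTensor_natural, dualMap_comp, Category.assoc, Iso.inv_hom_id_assoc]

lemma dualMap_lmul {A : VCat.{w} (FGProjCoalg k)} {x y z : A.carrier} {X : FGProjCoalg k}
    (p : 𝟙_ _ ⟶ A.hom x y) (a : X ⟶ A.hom y z) :
    dualMap (VCat.lmul p a) =
      DualVCat.rmul (C := obj A) (dualMap a) (dualMap p ≫ dualUnit.hom) := by
  change _ = (dualMap (eComp _ x y z) ≫ (dualTensor (A.hom x y) (A.hom y z)).inv) ≫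
    (dualMap a ⊗ₘ (dualMap p ≫ dualUnit.hom)) ≫ (ρ_ (dual X)).hom
  rw [VCat.lmul, dualMap_comp, dualMap_mul, Category.assoc _ _ (dualMap (λ_ X).inv),
    Category.assoc _ _ (dualMap (λ_ X).inv), ← dualUnit_right, ← id_tensorHom, MonoidalCategory.tensorHom_comp_tensorHom_assoc,
    Category.comp_id]

lemma dualMap_rmul {A : VCat.{w} (FGProjCoalg k)} {x y z : A.carrier} {X : FGProjCoalg k}
    (a : X ⟶ A.hom x y) (p : 𝟙_ _ ⟶ A.hom y z) :
    dualMap (VCat.rmul a p) =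
      DualVCat.lmul (C := obj A) (dualMap p ≫ dualUnit.hom) (dualMap a) := by
  change _ = (dualMap (eComp _ x y z) ≫ (dualTensor (A.hom x y) (A.hom y z)).inv) ≫
    ((dualMap p ≫ dualUnit.hom) ⊗ₘ dualMap a) ≫ (λ_ (dual X)).hom
  rw [VCat.rmul, dualMap_comp, dualMap_mul, Category.assoc _ _ (dualMap (ρ_ X).inv),
    Category.assoc _ _ (dualMap (ρ_ X).inv), ← dualUnit_left, ← tensorHom_id, MonoidalCategory.tensorHom_comp_tensorHom_assoc,
    Category.comp_id]

/-- The dual of an enriched functor: the same map on objects and `(f_{y,x})^*` on `C_{x,y}`. -/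
noncomputable def map {A B : VCat.{w} (FGProjCoalg k)} (f : VCat.Functor A B) :
    DualVCat.Functor (obj A) (obj B) where
  obj x := f.obj x
  map x y := dualMap (f.map y x)
  map_comul x y z := by
    have h := congrArg dualMap (f.fn.map_comp z y x)
    rw [dualMap_mul, dualMap_comp] at h
    have h' := h =≫ (dualTensor (A.hom z y) (A.hom y x)).inv
    rw [Category.assoc, Category.assoc _ _ (Iso.inv _), Category.assoc _ _ (Iso.inv _),
      Iso.hom_inv_id, Category.comp_id] at h'
    exact h'.symm
  map_counit x := by
    have h := congrArg (fun g => dualMap g ≫ dualUnit.hom) (f.fn.map_id x)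
    simp only [dualMap_comp, Category.assoc] at h
    exact h.symm

/-- The dual of an enriched natural transformation: the components are
`(α_x)^* : (B_{g x, f x})^* ⟶ k^* ≅ k`. -/
noncomputable def map₂ {A B : VCat.{w} (FGProjCoalg k)} {f g : VCat.Functor A B}
    (α : VCat.NatTrans f g) : DualVCat.NatTrans (map f) (map g) where
  app x := dualMap (α.app x) ≫ dualUnit.hom
  naturality x y := by
    have h := congrArg dualMap (α.nat y x)
    rw [dualMap_lmul, dualMap_rmul] at h
    exact h.symm

/-- The duality 2-functor `(-)^*` from categories enriched in coalgebras in finitely generated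
projective `k`-modules to dual categories enriched in algebras in finitely generated projective
`k`-modules. -/
noncomputable def duality (k : Type u) [CommRing k] :
    StrictPseudofunctor (VCat.{w} (FGProjCoalg k)) (DualVCat.{w} (FGProjAlg k)) :=
  StrictPseudofunctor.mk''
    { obj := obj
      map := fun f => map f
      map₂ := fun α => map₂ α
      map₂_id := fun f => rfl
      map₂_comp := fun {A B f g h} α β => DualVCat.cell_ext fun x => by
        have h := dualMap_lmul (β.app x) (α.app x)
        change dualMap (VCat.lmul (β.app x) (α.app x)) ≫ dualUnit.hom =
          DualVCat.lmul (C := obj B) (dualMap (α.app x) ≫ dualUnit.hom)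
            (dualMap (β.app x) ≫ dualUnit.hom)
        rw [h, DualVCat.rmul_comp, DualVCat.rmul_eq_lmul]
      map_id := fun A => rfl
      map_comp := fun f g => rfl
      map₂_whisker_left := fun {A B C} f {g g'} η => by
        let F : obj A ⟶ obj B := map f
        let G : obj B ⟶ obj C := map g
        let G' : obj B ⟶ obj C := map g'
        let N : G ⟶ G' := map₂ η
        exact ((Category.id_comp (Bicategory.whiskerLeft F N ≫ 𝟙 (F ≫ G'))).trans
          (Category.comp_id (Bicategory.whiskerLeft F N))).symm
      map₂_whisker_right := fun {A B C f f'} η g => by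
        let F : obj A ⟶ obj B := map f
        let F' : obj A ⟶ obj B := map f'
        let G : obj B ⟶ obj C := map g
        let N : F ⟶ F' := map₂ η
        exact ((Category.id_comp (Bicategory.whiskerRight N G ≫ 𝟙 (F' ≫ G))).trans
          (Category.comp_id (Bicategory.whiskerRight N G))).symm }

end Duality

section biequivalence

universe w₁ w₂ v₁ v₂ u₁ u₂

open scoped Pseudofunctor.StrongTrans

/-- A pseudofunctor `F : B → C` is a biequivalence if there is a pseudofunctor `G : C → B` such
that `G ∘ F` and `F ∘ G` are equivalent to the identities, in the bicategories of pseudofunctors,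
strong (pseudonatural) transformations and modifications. -/
def IsBiequivalence {B : Type u₁} [Bicategory.{w₁, v₁} B] {C : Type u₂}
    [Bicategory.{w₂, v₂} C] (F : Pseudofunctor B C) : Prop :=
  ∃ G : Pseudofunctor C B,
    Nonempty (Bicategory.Equivalence (F.comp G) (Pseudofunctor.id B)) ∧
      Nonempty (Bicategory.Equivalence (G.comp F) (Pseudofunctor.id C))

end biequivalence

/-! On finitely generated projective modules the linear dual is a contravariant equivalence. Its
compatibility with tensor products makes `C ↦ C^*` a contravariant equivalence from coalgebras to
algebras that reverses tensor factors. Faithfulness (`DualAlg.map_injective`) holds because linear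
forms separate points. Fullness (`DualAlg.map_surjective`) holds because the transpose of an algebra
morphism, read through `D ≅ D^{**}`, respects counit and comultiplication. Essential surjectivity
(`Predual.algEquiv`) holds because the multiplication of a finitely generated projective algebra
dualizes to a comultiplication, through `A^* ⊗ A^* ≅ (A ⊗ A)^*`.

Applied to each hom object, this gives the enriched statement. Functors between duals come from
unique enriched functors (`map_unmap`, `map_injective`). A 2-cell consists of points `k ⟶ C`, and
these correspond bijectively to algebra morphisms `C^* ⟶ k`. Every dual category `D` is isomorphic
to the dual of its predual by `eval` and `evalInv`, which are the identity on objects.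

The inverse pseudofunctor sends `D` to its predual, and a cell to the unique enriched cell whose
dual is its conjugate by these isomorphisms. Conjugation respects composition exactly, so the
constraints of the inverse and the naturality squares of the comparison transformations are
equalities of 1-cells, and the comparison 1-cells are mutually inverse on the nose. Coherence is
then automatic: both bicategories are strict, every diagram to check is built from `eqToHom`s, and
two parallel `eqToHom`s agree (`IsEqToHom.unique`). What remains is compatibility with 2-cells,
which reduces to cancelling `eval` against `evalInv`. -/

/-! ### Coherence by equality of 1-cells in strict bicategories. -/

section strict

universe w₁ w₂ v₁ v₂ u₁ u₂

open Bicategory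

section

variable {C : Type u₂} [Category.{v₂} C]

/-- A morphism of a category which is the identity, up to an equality of source and target. -/
class IsEqToHom {a b : C} (α : a ⟶ b) : Prop where
  out : ∃ h : a = b, α = eqToHom h

namespace IsEqToHom

/-- Proof irrelevance for the equality `a = b`. Together with the closure instances that follow, it
settles any diagram of structure 2-cells without comparing its two sides. -/
lemma unique {a b : C} (α β : a ⟶ b) [hα : IsEqToHom α] [hβ : IsEqToHom β] : α = β := by
  obtain ⟨_, rfl⟩ := hα
  obtain ⟨_, rfl⟩ := hβ
  rfl

instance eqToHom {a b : C} (h : a = b) : IsEqToHom (eqToHom h) := ⟨h, rfl⟩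

instance id (a : C) : IsEqToHom (𝟙 a) := ⟨rfl, rfl⟩

instance comp {a b c : C} (α : a ⟶ b) (β : b ⟶ c) [hα : IsEqToHom α] [hβ : IsEqToHom β] :
    IsEqToHom (α ≫ β) := by
  obtain ⟨rfl, rfl⟩ := hα
  obtain ⟨rfl, rfl⟩ := hβ
  exact ⟨rfl, by simp⟩

instance inv {a b : C} (α : a ≅ b) [hα : IsEqToHom α.hom] : IsEqToHom α.inv := by
  obtain ⟨rfl, h⟩ := hα
  refine ⟨rfl, ?_⟩
  rw [← cancel_epi α.hom, α.hom_inv_id, h]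
  simp

end IsEqToHom
end

variable {B : Type u₁} [Bicategory.{w₁, v₁} B] {C : Type u₂} [Bicategory.{w₂, v₂} C]

namespace IsEqToHom

instance whiskerLeft {a b c : C} (f : a ⟶ b) {g h : b ⟶ c} (α : g ⟶ h) [hα : IsEqToHom α] :
    IsEqToHom (f ◁ α) := by
  obtain ⟨rfl, rfl⟩ := hα
  exact ⟨rfl, by simp⟩

instance whiskerRight {a b c : C} {f g : a ⟶ b} (α : f ⟶ g) (h : b ⟶ c) [hα : IsEqToHom α] :
    IsEqToHom (α ▷ h) := by
  obtain ⟨rfl, rfl⟩ := hα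
  exact ⟨rfl, by simp⟩

instance map₂ (F : PrelaxFunctor B C) {a b : B} {f g : a ⟶ b} (α : f ⟶ g) [hα : IsEqToHom α] :
    IsEqToHom (F.map₂ α) := by
  obtain ⟨rfl, rfl⟩ := hα
  exact ⟨rfl, by simp⟩

variable [Strict C]

instance leftUnitor {a b : C} (f : a ⟶ b) : IsEqToHom (Bicategory.leftUnitor f).hom := by
  rw [Strict.leftUnitor_eqToIso, eqToIso.hom]; infer_instance

instance rightUnitor {a b : C} (f : a ⟶ b) : IsEqToHom (Bicategory.rightUnitor f).hom := by
  rw [Strict.rightUnitor_eqToIso, eqToIso.hom]; infer_instance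

instance associator {a b c d : C} (f : a ⟶ b) (g : b ⟶ c) (h : c ⟶ d) :
    IsEqToHom (Bicategory.associator f g h).hom := by
  rw [Strict.associator_eqToIso, eqToIso.hom]; infer_instance

end IsEqToHom

/-! ### Pseudofunctors and transformations whose constraints are equalities. -/

namespace CategoryTheory.Pseudofunctor

/-- A pseudofunctor whose structure 2-cells are identities, up to equality of 1-cells. -/
class HasStrictConstraints (F : Pseudofunctor B C) : Prop where
  mapId (a : B) : IsEqToHom (F.mapId a).hom
  mapComp {a b c : B} (f : a ⟶ b) (g : b ⟶ c) : IsEqToHom (F.mapComp f g).hom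

attribute [instance] HasStrictConstraints.mapId HasStrictConstraints.mapComp

instance (B : Type u₁) [Bicategory.{w₁, v₁} B] : HasStrictConstraints (Pseudofunctor.id B) where
  mapId _ := IsEqToHom.id _
  mapComp _ _ := IsEqToHom.id _

instance (F : StrictPseudofunctor B C) : HasStrictConstraints F.toPseudofunctor where
  mapId a := by rw [F.mapId_eq_eqToIso, eqToIso.hom]; infer_instance
  mapComp f g := by rw [F.mapComp_eq_eqToIso, eqToIso.hom]; infer_instance

instance {D : Type*} [Bicategory D] (F : Pseudofunctor B C) (G : Pseudofunctor C D)
    [HasStrictConstraints F] [HasStrictConstraints G] : HasStrictConstraints (F.comp G) where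
  mapId a := inferInstanceAs (IsEqToHom (G.map₂ (F.mapId a).hom ≫ (G.mapId (F.obj a)).hom))
  mapComp f g := inferInstanceAs
    (IsEqToHom (G.map₂ (F.mapComp f g).hom ≫ (G.mapComp (F.map f) (F.map g)).hom))

variable [Strict C] {P Q : Pseudofunctor B C}

/-- The strong transformation given by a family of 1-cells which is natural up to equality of
1-cells. -/
def strongTransOfStrict [HasStrictConstraints P] [HasStrictConstraints Q]
    (app : ∀ a, P.obj a ⟶ Q.obj a)
    (nat : ∀ {a b : B} (f : a ⟶ b), P.map f ≫ app b ≅ app a ≫ Q.map f)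
    (hnat : ∀ {a b : B} (f : a ⟶ b), IsEqToHom (nat f).hom)
    (nat₂ : ∀ {a b : B} {f g : a ⟶ b} (η : f ⟶ g),
      P.map₂ η ▷ app b ≫ (nat g).hom = (nat f).hom ≫ app a ◁ Q.map₂ η) :
    StrongTrans P Q where
  app := app
  naturality := nat
  naturality_naturality := nat₂
  -- In both remaining axioms each side is a composite of whiskered constraints, unitors,
  -- associators and the cells `nat`, all of them `eqToHom`s; only `nat₂` involves arbitrary
  -- 2-cells.
  naturality_id a := by
    have := hnat (𝟙 a)
    exact IsEqToHom.unique _ _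
  naturality_comp f g := by
    have := hnat (f ≫ g)
    have := hnat f
    have := hnat g
    exact IsEqToHom.unique _ _

open scoped Pseudofunctor.StrongTrans

instance {F G H : Pseudofunctor B C} (η : F ⟶ G) (θ : G ⟶ H)
    [∀ {a b : B} (f : a ⟶ b), IsEqToHom (η.naturality f).hom]
    [∀ {a b : B} (f : a ⟶ b), IsEqToHom (θ.naturality f).hom] {a b : B} (f : a ⟶ b) :
    IsEqToHom ((η ≫ θ).naturality f).hom := by
  change IsEqToHom ((Bicategory.associator (F.map f) (η.app b) (θ.app b)).inv ≫
      (η.naturality f).hom ▷ θ.app b ≫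
        (Bicategory.associator (η.app a) (G.map f) (θ.app b)).hom ≫
          η.app a ◁ (θ.naturality f).hom ≫
            (Bicategory.associator (η.app a) (θ.app a) (H.map f)).inv)
  infer_instance

instance {F : Pseudofunctor B C} {a b : B} (f : a ⟶ b) :
    IsEqToHom (StrongTrans.naturality (𝟙 F) f).hom := by
  change IsEqToHom ((Bicategory.rightUnitor (F.map f)).hom ≫ (Bicategory.leftUnitor (F.map f)).inv)
  infer_instance

/-- Strong transformations with the same 1-cells, natural up to equality of 1-cells, are
isomorphic. -/
def strongTransIso {η θ : P ⟶ Q}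
    [∀ {a b : B} (f : a ⟶ b), IsEqToHom (η.naturality f).hom]
    [∀ {a b : B} (f : a ⟶ b), IsEqToHom (θ.naturality f).hom]
    (h : ∀ a, η.app a = θ.app a) : η ≅ θ :=
  StrongTrans.isoMk (fun a => eqToIso (h a)) fun f => by
    simp only [eqToIso.hom]
    exact IsEqToHom.unique _ _

/-- Pseudofunctors related by mutually inverse transformations, natural up to equality of 1-cells,
are equivalent. -/
def equivalenceOfStrict (η : P ⟶ Q) (θ : Q ⟶ P)
    [∀ {a b : B} (f : a ⟶ b), IsEqToHom (η.naturality f).hom]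
    [∀ {a b : B} (f : a ⟶ b), IsEqToHom (θ.naturality f).hom]
    (h₁ : ∀ a, η.app a ≫ θ.app a = 𝟙 (P.obj a)) (h₂ : ∀ a, θ.app a ≫ η.app a = 𝟙 (Q.obj a)) :
    Bicategory.Equivalence P Q :=
  -- No triangle identity has to be checked: the counit is replaced by one adjusted to the unit.
  Equivalence.mkOfAdjointifyCounit (f := η) (g := θ)
    (strongTransIso fun a => (h₁ a).symm) (strongTransIso fun a => h₂ a)

end CategoryTheory.Pseudofunctor

end strict

/-! ### The dual coalgebra of a finitely generated projective algebra. -/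

section predual

variable {k : Type u} [CommRing k]

/-- The map factors as `M^* ⊗ N^* ≅ Hom(M, N^*) ≅ (M ⊗ N)^*`, and only the first isomorphism uses
finiteness and projectivity, of `M` alone. -/
lemma TensorProduct.dualDistrib_bijective (M N : Type*) [AddCommGroup M] [Module k M]
    [AddCommGroup N] [Module k N] [Module.Finite k M] [Module.Projective k M] :
    Function.Bijective (TensorProduct.dualDistrib k M N) := by
  have h : TensorProduct.dualDistrib k M N =
      ((dualTensorHomEquiv k M (N →ₗ[k] k)).trans (TensorProduct.lift.equiv (.id k) M N k)) := by
    ext f g m n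
    simp
  rw [h]
  exact LinearEquiv.bijective _

/-- Reflexivity of `M`: evaluation into the double dual is injective. -/
lemma Module.Dual.ext_of_projective {M : Type*} [AddCommGroup M] [Module k M]
    [Module.Finite k M] [Module.Projective k M] {x y : M}
    (h : ∀ f : Module.Dual k M, f x = f y) : x = y :=
  (Module.evalEquiv k M).injective (LinearMap.ext h)

/-- Contraction of both legs against elements of the algebra. -/
lemma Predual.mul'_map_eval {A : Type u} [Ring A] [Algebra k A]
    (t : Module.Dual k A ⊗[k] Module.Dual k A) (x y : A) :
    LinearMap.mul' k k (TensorProduct.map (Module.Dual.eval k A x) (Module.Dual.eval k A y) t) =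
      TensorProduct.dualDistrib k A A t (x ⊗ₜ y) := by
  induction t with
  | zero => simp
  | add s t hs ht => simp only [map_add, hs, ht, LinearMap.add_apply]
  | tmul f g => simp

variable (A : Type u) [Ring A] [Algebra k A] [Module.Finite k A] [Module.Projective k A]

namespace Predual

/-- The comultiplication of the dual of a finitely generated projective algebra,
`f_(1)(x) f_(2)(y) = f(yx)`. -/
noncomputable def comul : Module.Dual k A →ₗ[k] Module.Dual k A ⊗[k] Module.Dual k A :=
  -- The swap `comm` makes this the transpose of the opposite multiplication; it compensates for the
  -- opposite convolution product on `DualAlg`.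
  (LinearEquiv.ofBijective _ (TensorProduct.dualDistrib_bijective A A)).symm.toLinearMap ∘ₗ
    (LinearMap.mul' k A ∘ₗ (TensorProduct.comm k A A).toLinearMap).dualMap

variable {A}

/-- This pairing determines `comul` without mentioning the inverse in its definition; the coalgebra
axioms are all verified through it. -/
lemma dualDistrib_comul (f : Module.Dual k A) (x y : A) :
    TensorProduct.dualDistrib k A A (comul A f) (x ⊗ₜ y) = f (y * x) := by
  have := (LinearEquiv.ofBijective _
    (TensorProduct.dualDistrib_bijective (k := k) A A)).apply_symm_apply
      ((LinearMap.mul' k A ∘ₗ (TensorProduct.comm k A A).toLinearMap).dualMap f)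
  exact congr($this (x ⊗ₜ y))

variable (k A) in
/-- The dual of a finitely generated projective algebra, as a coalgebra. -/
@[reducible] noncomputable def coalgebra : Coalgebra k (Module.Dual k A) where
  comul := comul A
  counit := Module.Dual.eval k A 1
  coassoc := by
    -- Elements of `A^* ⊗ (A^* ⊗ A^*)` are separated by pairing with `x ⊗ (y ⊗ z)`, so
    -- coassociativity becomes an identity of scalars.
    have hinj : Function.Injective (TensorProduct.dualDistrib k A (A ⊗[k] A) ∘ₗ
        (LinearEquiv.lTensor (Module.Dual k A) (LinearEquiv.ofBijective _
          (TensorProduct.dualDistrib_bijective (k := k) A A))).toLinearMap) :=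
      (TensorProduct.dualDistrib_bijective A (A ⊗[k] A)).injective.comp (LinearEquiv.injective _)
    have h₁ (t : Module.Dual k A ⊗[k] Module.Dual k A) (g : Module.Dual k A) (x y z : A) :
        TensorProduct.dualDistrib k A (A ⊗[k] A) ((LinearEquiv.lTensor (Module.Dual k A)
          (LinearEquiv.ofBijective _ (TensorProduct.dualDistrib_bijective (k := k) A A)))
            (TensorProduct.assoc k _ _ _ (t ⊗ₜ g))) (x ⊗ₜ (y ⊗ₜ z)) =
        TensorProduct.dualDistrib k A A t (x ⊗ₜ y) * g z := by
      induction t with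
      | zero => simp
      | add s t hs ht =>
        simp only [map_add, TensorProduct.add_tmul, hs, ht, LinearMap.add_apply, add_mul]
      | tmul f f' =>
        change f x * (f' y * g z) = f x * f' y * g z
        ring
    refine LinearMap.ext fun f => hinj (TensorProduct.ext_threefold' fun x y z => ?_)
    have h₂ (t : Module.Dual k A ⊗[k] Module.Dual k A) :
        TensorProduct.dualDistrib k A (A ⊗[k] A) ((LinearEquiv.lTensor (Module.Dual k A)
          (LinearEquiv.ofBijective _ (TensorProduct.dualDistrib_bijective (k := k) A A)))
            (TensorProduct.assoc k _ _ _ ((comul A).rTensor _ t))) (x ⊗ₜ (y ⊗ₜ z)) =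
        TensorProduct.dualDistrib k A A t ((y * x) ⊗ₜ z) := by
      induction t with
      | zero => simp
      | add s t hs ht => simp only [map_add, hs, ht, LinearMap.add_apply]
      | tmul f f' => rw [LinearMap.rTensor_tmul, h₁, dualDistrib_comul]; simp
    have h₃ (t : Module.Dual k A ⊗[k] Module.Dual k A) :
        TensorProduct.dualDistrib k A (A ⊗[k] A) ((LinearEquiv.lTensor (Module.Dual k A)
          (LinearEquiv.ofBijective _ (TensorProduct.dualDistrib_bijective (k := k) A A)))
            ((comul A).lTensor _ t)) (x ⊗ₜ (y ⊗ₜ z)) =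
        TensorProduct.dualDistrib k A A t (x ⊗ₜ (z * y)) := by
      induction t with
      | zero => simp
      | add s t hs ht => simp only [map_add, hs, ht, LinearMap.add_apply]
      | tmul f f' =>
        change f x * TensorProduct.dualDistrib k A A (comul A f') (y ⊗ₜ z) = f x * f' (z * y)
        rw [dualDistrib_comul]
    -- The two sides pair to `f (z * (y * x))` and `f ((z * y) * x)`.
    refine (h₂ (comul A f)).trans (Eq.trans ?_ (h₃ (comul A f)).symm)
    rw [dualDistrib_comul, dualDistrib_comul, mul_assoc]
  rTensor_counit_comp_comul := by
    refine LinearMap.ext fun f => (TensorProduct.lid k _).injective (LinearMap.ext fun y => ?_)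
    have h (t : Module.Dual k A ⊗[k] Module.Dual k A) :
        (TensorProduct.lid k _ ((Module.Dual.eval k A 1).rTensor _ t)) y =
          TensorProduct.dualDistrib k A A t (1 ⊗ₜ y) := by
      induction t with
      | zero => simp
      | add s t hs ht => simp only [map_add, hs, ht, LinearMap.add_apply]
      | tmul f f' => simp
    refine (h _).trans ?_
    rw [dualDistrib_comul]
    simp
  lTensor_counit_comp_comul := by
    refine LinearMap.ext fun f => (TensorProduct.rid k _).injective (LinearMap.ext fun y => ?_)
    have h (t : Module.Dual k A ⊗[k] Module.Dual k A) :
        (TensorProduct.rid k _ ((Module.Dual.eval k A 1).lTensor _ t)) y =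
          TensorProduct.dualDistrib k A A t (y ⊗ₜ 1) := by
      induction t with
      | zero => simp
      | add s t hs ht => simp only [map_add, hs, ht, LinearMap.add_apply]
      | tmul f f' => simp [mul_comm]
    refine (h _).trans ?_
    rw [dualDistrib_comul]
    simp

attribute [local instance] coalgebra

variable (k A) in
/-- A finitely generated projective algebra is the dual of its dual coalgebra. -/
noncomputable def algEquiv : A ≃ₐ[k] DualAlg k (Module.Dual k A) :=
  AlgEquiv.ofLinearEquiv
    ((Module.evalEquiv k A).trans (DualAlg.linearEquiv k (Module.Dual k A)).symm)
    rfl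
    (fun x y => DualAlg.ext_form <| LinearMap.ext fun f => by
      -- The two reversals cancel: the opposite convolution of evaluation at `x` and at `y` pairs
      -- `comul A f` with `y ⊗ x`, and that is `f (x * y)`.
      refine Eq.trans ?_ (mul'_map_eval (comul A f) y x).symm
      rw [dualDistrib_comul]
      rfl)

end Predual

end predual

/-! ### The dual is fully faithful on finitely generated projective coalgebras. -/

namespace DualAlg

variable {k : Type u} [CommRing k]
  {C D : Type u} [AddCommGroup C] [Module k C] [Coalgebra k C]
  [AddCommGroup D] [Module k D] [Coalgebra k D]

/-- The value `f c` is known once every form on `D` is known on it, and those values are recorded by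
`map f`. -/
lemma map_injective [Module.Finite k D] [Module.Projective k D] :
    Function.Injective (map : (C →ₗc[k] D) → _) := fun f g h => by
  refine CoalgHom.ext fun c => Module.Dual.ext_of_projective (k := k) fun φ => ?_
  exact congr((form ($h (of φ)) : C →ₗ[k] k) c)

/-- The candidate is the composite `C → C^{**} → D^{**} ≅ D` with the transpose of `F` in the
middle. Preservation of `1` by `F` gives compatibility with counits, and multiplicativity gives
compatibility with comultiplications. -/
lemma map_surjective [Module.Finite k D] [Module.Projective k D] :
    Function.Surjective (map : (C →ₗc[k] D) → _) := fun F => by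
  let f : C →ₗ[k] D := (Module.evalEquiv k D).symm.toLinearMap ∘ₗ
    ((linearEquiv k C).toLinearMap ∘ₗ F.toLinearMap ∘ₗ
      (linearEquiv k D).symm.toLinearMap).dualMap ∘ₗ Module.Dual.eval k C
  have hf (φ : DualAlg k D) (c : C) : φ.form (f c) = (F φ).form c :=
    Module.apply_evalEquiv_symm_apply k D _ _
  refine ⟨{ f with
    counit_comp := LinearMap.ext fun c => ?_
    map_comp_comul := LinearMap.ext fun c => ?_ }, ?_⟩
  · have := hf 1 c
    rw [map_one] at this
    exact this
  · refine Module.Dual.ext_of_projective (k := k) fun Φ => ?_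
    -- Forms on `D ⊗ D` are sums of products `ψ ⊗ φ` of forms, so testing against these suffices.
    obtain ⟨t, rfl⟩ := (TensorProduct.dualDistrib_bijective D D).surjective Φ
    induction t with
    | zero => simp
    | add s t hs ht => simp only [map_add, LinearMap.add_apply, hs, ht]
    | tmul ψ φ =>
      -- The factors appear in this order because the product is opposite: applying `ψ ⊗ φ` to the
      -- comultiplication computes `φ * ψ`.
      have h := hf (of φ * of ψ) c
      rw [map_mul, form_mul, form_mul] at h
      have h₁ (s : D ⊗[k] D) : TensorProduct.dualDistrib k D D (ψ ⊗ₜ φ) s =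
          LinearMap.mul' k k (TensorProduct.map ψ φ s) := by
        induction s with
        | zero => simp
        | add s t hs ht => simp only [map_add, hs, ht]
        | tmul c d => simp
      have h₂ (s : C ⊗[k] C) : LinearMap.mul' k k (TensorProduct.map ψ φ
          (TensorProduct.map f f s)) =
          LinearMap.mul' k k (TensorProduct.map (F (of ψ)).form (F (of φ)).form s) := by
        rw [TensorProduct.map_map]
        congr 3 <;> exact LinearMap.ext fun c => hf (of _) c
      rw [h₁, h₁]
      exact (h₂ _).trans h.symm
  · exact AlgHom.ext fun φ => ext_form (LinearMap.ext fun c => hf φ c)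

end DualAlg

/-! ### The contravariant equivalence between coalgebras and algebras. -/

namespace FGProjCoalg

variable {k : Type u} [CommRing k]

lemma dualMap_injective {C D : FGProjCoalg k} : Function.Injective (dualMap : (C ⟶ D) → _) :=
  fun f g h => by
    apply ObjectProperty.hom_ext
    apply CoalgCat.hom_ext
    exact DualAlg.map_injective (AlgHom.ext fun a => congr(($h).hom.hom a))

/-- The coalgebra morphism whose dual is a given algebra morphism. -/
noncomputable def undual {C D : FGProjCoalg k} (F : dual D ⟶ dual C) : C ⟶ D :=
  ObjectProperty.homMk (CoalgCat.ofHom (DualAlg.map_surjective (C := C.obj) (D := D.obj)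
    F.hom.hom).choose)

lemma dualMap_undual {C D : FGProjCoalg k} (F : dual D ⟶ dual C) : dualMap (undual F) = F := by
  apply hom_ext_alg
  intro a
  exact congr($((DualAlg.map_surjective (C := C.obj) (D := D.obj) F.hom.hom).choose_spec) a)

attribute [local instance] Predual.coalgebra in
/-- The dual coalgebra of a finitely generated projective algebra. -/
noncomputable def predual (A : FGProjAlg k) : FGProjCoalg k :=
  have := A.property.1
  have := A.property.2
  ⟨CoalgCat.of k (Module.Dual k A.obj), inferInstanceAs (Module.Finite k (Module.Dual k A.obj)),
    inferInstanceAs (Module.Projective k (Module.Dual k A.obj))⟩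

attribute [local instance] Predual.coalgebra in
/-- An algebra is the dual of its dual coalgebra. -/
noncomputable def predualIso (A : FGProjAlg k) : dual (predual A) ≅ A :=
  have := A.property.1
  have := A.property.2
  (isFGProjAlg k).isoMk (Predual.algEquiv k A.obj).symm.toAlgebraIso

end FGProjCoalg

/-! ### 2-cells between equal 1-cells, and transport of dual categories. -/

namespace VCat

variable {V : Type u} [Category.{v} V] [MonoidalCategory V] {A B : VCat.{w} V}

/-- The 2-cell between equal 1-cells whose components are units, up to a cast of their type. -/
def eqCell {f g : Functor A B} (h : f = g) : NatTrans f g where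
  -- Unlike the component of `eqToHom h`, this reduces to `eId` by definition whenever `f` and `g`
  -- have definitionally equal object maps, even if their equality as functors is only
  -- propositional. This lets the unit laws be applied directly to constraint components.
  app x := cast (congrArg (fun t : Functor A B => (𝟙_ V ⟶ B.hom (t.obj x) (f.obj x))) h)
    (eId V (f.obj x))
  naturality := by subst h; exact (NatTrans.id f).naturality

lemma eqCell_eq_eqToHom {f g : A ⟶ B} (h : f = g) : eqCell h = eqToHom h := by
  subst h; rfl

/-- The invertible 2-cell between equal 1-cells. -/
def eqIso {f g : A ⟶ B} (h : f = g) : f ≅ g where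
  hom := eqCell h
  inv := eqCell h.symm
  hom_inv_id := by subst h; exact Category.id_comp (𝟙 f)
  inv_hom_id := by subst h; exact Category.id_comp (𝟙 f)

instance isEqToHom_eqIso {f g : A ⟶ B} (h : f = g) : IsEqToHom (eqIso h).hom :=
  ⟨h, eqCell_eq_eqToHom h⟩

/-- This is the shape of a component of a 2-cell conjugated by composition constraints, as in the
whiskering axioms of `predualPseudofunctor`. -/
lemma lmul_eId_lmul {x y : A.carrier} (p : 𝟙_ V ⟶ A.hom x y) :
    lmul (lmul (eId V x) p) (eId V y) = p := by
  rw [lmul_pt_eId, lmul_eId]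

end VCat

namespace DualVCat

variable {V : Type u} [Category.{v} V] [MonoidalCategory V] {C D : DualVCat.{w} V}

/-- The 2-cell between equal 1-cells whose components are counits, up to a cast of their type. -/
def eqCell {f g : Functor C D} (h : f = g) : NatTrans f g where
  app x := cast (congrArg (fun t : Functor C D => (D.hom (f.obj x) (t.obj x) ⟶ 𝟙_ V)) h)
    (D.counit (f.obj x))
  naturality := by subst h; exact (NatTrans.id f).naturality

lemma eqCell_eq_eqToHom {f g : C ⟶ D} (h : f = g) : eqCell h = eqToHom h := by
  subst h; rfl

/-- The invertible 2-cell between equal 1-cells. -/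
def eqIso {f g : C ⟶ D} (h : f = g) : f ≅ g where
  hom := eqCell h
  inv := eqCell h.symm
  hom_inv_id := by subst h; exact Category.id_comp (𝟙 f)
  inv_hom_id := by subst h; exact Category.id_comp (𝟙 f)

instance isEqToHom_eqIso {f g : C ⟶ D} (h : f = g) : IsEqToHom (eqIso h).hom :=
  ⟨h, eqCell_eq_eqToHom h⟩

namespace Functor

variable {E F : DualVCat.{w} V}

lemma comp_assoc (f : Functor C D) (g : Functor D E) (h : Functor E F) :
    (f.comp g).comp h = f.comp (g.comp h) :=
  ext' (fun _ => rfl) fun x y =>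
    (Category.assoc _ _ (f.map x y)).symm.trans (Category.id_comp _).symm

lemma id_comp (f : Functor C D) : (id C).comp f = f :=
  ext' (fun _ => rfl) fun x y =>
    (Category.comp_id (f.map x y)).trans (Category.id_comp (f.map x y)).symm

lemma comp_id (f : Functor C D) : f.comp (id D) = f :=
  ext' (fun _ => rfl) fun _ _ => rfl

end Functor

/-- Transport of the structure of a dual `V`-category along isomorphisms `W_{x,y} ≅ D_{x,y}`. -/
def transport (D : DualVCat.{w} V) (W : D.carrier → D.carrier → V)
    (e : ∀ x y, W x y ≅ D.hom x y) : DualVCat.{w} V where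
  carrier := D.carrier
  hom := W
  comul x y z := (e x z).hom ≫ D.comul x y z ≫ ((e x y).inv ⊗ₘ (e y z).inv)
  counit x := (e x x).hom ≫ D.counit x
  coassoc x y z t := by
    -- After the inner pairs of `e` and its inverse cancel, coassociativity of `D` postcomposed with
    -- the three inverses is what is left.
    have h := comul_assoc (e x y).inv (e y z).inv (e z t).inv
    simp only [← tensorHom_id, ← id_tensorHom, Category.assoc,
      MonoidalCategory.tensorHom_comp_tensorHom_assoc,
      MonoidalCategory.tensorHom_comp_tensorHom, Iso.inv_hom_id_assoc, Category.comp_id]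
    rw [h]
  counit_comul x y := by
    have h := lmul_counit (e x y).inv
    simp only [lmul] at h
    simp only [← tensorHom_id, Category.assoc,
      MonoidalCategory.tensorHom_comp_tensorHom_assoc, Iso.inv_hom_id_assoc, Category.comp_id]
    rw [h, Iso.hom_inv_id]
  comul_counit x y := by
    have h := rmul_counit (e x y).inv
    simp only [rmul] at h
    simp only [← id_tensorHom, Category.assoc,
      MonoidalCategory.tensorHom_comp_tensorHom_assoc, Iso.inv_hom_id_assoc, Category.comp_id]
    rw [h, Iso.hom_inv_id]

end DualVCat

/-! ### Structure maps and points recovered from their duals. -/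

namespace FGProjCoalg

variable {k : Type u} [CommRing k]

lemma dualTensor_whiskerRight {C C' : FGProjCoalg k} (f : C ⟶ C') (D : FGProjCoalg k) :
    (dualTensor C' D).hom ≫ dualMap (f ▷ D) = dual D ◁ dualMap f ≫ (dualTensor C D).hom := by
  have h := dualTensor_natural f (𝟙 D)
  rw [dualMap_id, tensorHom_id, id_tensorHom] at h
  exact h.symm

lemma dualTensor_whiskerLeft (C : FGProjCoalg k) {D D' : FGProjCoalg k} (f : D ⟶ D') :
    (dualTensor C D').hom ≫ dualMap (C ◁ f) = dualMap f ▷ dual C ≫ (dualTensor C D).hom := by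
  have h := dualTensor_natural (𝟙 C) f
  rw [dualMap_id, tensorHom_id, id_tensorHom] at h
  exact h.symm

lemma dualMap_undual_comp_inv {C D E : FGProjCoalg k} (f : dual E ⟶ dual D ⊗ dual C) :
    dualMap (undual (f ≫ (dualTensor C D).hom)) ≫ (dualTensor C D).inv = f := by
  rw [dualMap_undual, Category.assoc, Iso.hom_inv_id, Category.comp_id]

/-- The point of `C` given by a morphism `C^* ⟶ k`. -/
noncomputable def undualPoint {C : FGProjCoalg k} (p : dual C ⟶ 𝟙_ (FGProjAlg k)) :
    𝟙_ (FGProjCoalg k) ⟶ C :=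
  undual (p ≫ dualUnit.inv)

lemma dualMap_undualPoint {C : FGProjCoalg k} (p : dual C ⟶ 𝟙_ (FGProjAlg k)) :
    dualMap (undualPoint p) ≫ dualUnit.hom = p := by
  rw [undualPoint, dualMap_undual, Category.assoc, Iso.inv_hom_id, Category.comp_id]

lemma undualPoint_comp {C C' : FGProjCoalg k} (F : dual C' ⟶ dual C)
    (p : dual C ⟶ 𝟙_ (FGProjAlg k)) : undualPoint (F ≫ p) = undualPoint p ≫ undual F := by
  apply dualMap_injective
  rw [dualMap_comp, undualPoint, undualPoint, dualMap_undual, dualMap_undual, dualMap_undual,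
    Category.assoc]

lemma point_ext {C : FGProjCoalg k} {p q : 𝟙_ (FGProjCoalg k) ⟶ C}
    (h : dualMap p ≫ dualUnit.hom = dualMap q ≫ dualUnit.hom) : p = q :=
  dualMap_injective ((cancel_mono _).1 h)

lemma undualPoint_dualMap {C : FGProjCoalg k} (p : 𝟙_ (FGProjCoalg k) ⟶ C) :
    undualPoint (dualMap p ≫ dualUnit.hom) = p :=
  point_ext (dualMap_undualPoint _)

end FGProjCoalg

/-! ### Preduals of dual categories, and lifting of functors and 2-cells through the duality. -/

namespace Duality

variable {k : Type u} [CommRing k]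

open FGProjCoalg

/-- The category enriched in coalgebras whose dual has given homs and structure maps. -/
noncomputable abbrev ofDual (X : Type w) (C : X → X → FGProjCoalg k)
    (Δ : ∀ x y z, dual (C z x) ⟶ dual (C y x) ⊗ dual (C z y))
    (ε : ∀ x, dual (C x x) ⟶ 𝟙_ (FGProjAlg k))
    (coassoc : ∀ x y z t,
      Δ x z t ≫ Δ x y z ▷ dual (C t z) ≫ (α_ _ _ _).hom = Δ x y t ≫ dual (C y x) ◁ Δ y z t)
    (counit_comul : ∀ x y, Δ x x y ≫ ε x ▷ dual (C y x) ≫ (λ_ _).hom = 𝟙 _)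
    (comul_counit : ∀ x y, Δ x y y ≫ dual (C y x) ◁ ε y ≫ (ρ_ _).hom = 𝟙 _) :
    VCat.{w} (FGProjCoalg k) where
  carrier := X
  str :=
    { Hom := C
      id x := undualPoint (ε x)
      comp x y z := undual (Δ z y x ≫ (dualTensor (C x y) (C y z)).hom)
      -- The axioms may be checked after `dualMap`, which is faithful. It reverses tensor factors,
      -- so the left unit law comes from the right counit law with the objects exchanged, and the
      -- right one from the left.
      id_comp x y := by
        apply dualMap_injective
        simp only [dualMap_comp, dualMap_undual, Category.assoc]
        rw [reassoc_of% dualTensor_whiskerRight, ← dualUnit_right,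
          ← MonoidalCategory.whiskerLeft_comp_assoc, dualMap_undualPoint]
        exact comul_counit y x
      comp_id x y := by
        apply dualMap_injective
        simp only [dualMap_comp, dualMap_undual, Category.assoc]
        rw [reassoc_of% dualTensor_whiskerLeft, ← dualUnit_left,
          ← MonoidalCategory.comp_whiskerRight_assoc, dualMap_undualPoint]
        exact counit_comul y x
      assoc x y z t := by
        apply dualMap_injective
        simp only [dualMap_comp, dualMap_undual, Category.assoc]
        rw [reassoc_of% dualTensor_whiskerRight, dualTensor_whiskerLeft, dualMap_undual,
          dualMap_undual, MonoidalCategory.comp_whiskerRight, MonoidalCategory.whiskerLeft_comp,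
          Category.assoc, Category.assoc, ← dualTensor_assoc,
          reassoc_of% (coassoc t z y x)] }

/-- The category enriched in coalgebras predual to a dual category. -/
noncomputable abbrev predualObj (D : DualVCat.{w} (FGProjAlg k)) : VCat.{w} (FGProjCoalg k) :=
  let E := D.transport (fun x y => dual (predual (D.hom x y))) fun x y => predualIso (D.hom x y)
  ofDual D.carrier (fun x y => predual (D.hom y x)) E.comul E.counit E.coassoc E.counit_comul
    E.comul_counit

/-- The double dual carries exactly the structure transported along `predualIso`; hence these
isomorphisms assemble into the dual functors `eval` and `evalInv`. -/
lemma obj_predualObj_comul (D : DualVCat.{w} (FGProjAlg k)) (x y z : D.carrier) :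
    (obj (predualObj D)).comul x y z = (predualIso (D.hom x z)).hom ≫ D.comul x y z ≫
      ((predualIso (D.hom x y)).inv ⊗ₘ (predualIso (D.hom y z)).inv) :=
  (dualMap_undual_comp_inv _).trans rfl

lemma obj_predualObj_counit (D : DualVCat.{w} (FGProjAlg k)) (x : D.carrier) :
    (obj (predualObj D)).counit x = (predualIso (D.hom x x)).hom ≫ D.counit x :=
  dualMap_undualPoint _

/-- The isomorphism from the dual of the predual of a dual category `D` to `D`. -/
noncomputable def eval (D : DualVCat.{w} (FGProjAlg k)) :
    DualVCat.Functor (obj (predualObj D)) D where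
  obj x := x
  map x y := (predualIso (D.hom x y)).inv
  map_comul x y z := by rw [obj_predualObj_comul, Iso.inv_hom_id_assoc]
  map_counit x := by rw [obj_predualObj_counit, Iso.inv_hom_id_assoc]

/-- The inverse of `eval`. -/
noncomputable def evalInv (D : DualVCat.{w} (FGProjAlg k)) :
    DualVCat.Functor D (obj (predualObj D)) where
  obj x := x
  map x y := (predualIso (D.hom x y)).hom
  map_comul x y z := by
    rw [obj_predualObj_comul, Category.assoc, Category.assoc,
      MonoidalCategory.tensorHom_comp_tensorHom, Iso.inv_hom_id, Iso.inv_hom_id,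
      id_tensorHom_id, Category.comp_id]
  map_counit x := obj_predualObj_counit D x

lemma eval_comp_evalInv (D : DualVCat.{w} (FGProjAlg k)) :
    (eval D).comp (evalInv D) = DualVCat.Functor.id _ :=
  DualVCat.Functor.ext' (fun _ => rfl) fun x y =>
    (predualIso (D.hom x y)).hom_inv_id.trans (Category.id_comp _).symm

lemma evalInv_comp_eval (D : DualVCat.{w} (FGProjAlg k)) :
    (evalInv D).comp (eval D) = DualVCat.Functor.id _ :=
  DualVCat.Functor.ext' (fun _ => rfl) fun x y =>
    (predualIso (D.hom x y)).inv_hom_id.trans (Category.id_comp _).symm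

variable {A B C : VCat.{w} (FGProjCoalg k)}

/-- The enriched functor with a given dual. -/
noncomputable def unmap (f : DualVCat.Functor (obj A) (obj B)) : VCat.Functor A B where
  fn :=
    { obj x := f.obj x
      map x y := undual (f.map y x)
      map_id x := by
        apply point_ext
        rw [dualMap_comp, dualMap_undual, Category.assoc]
        exact (f.map_counit x).symm
      map_comp x y z := by
        apply dualMap_injective
        rw [dualMap_comp, dualMap_undual, dualMap_mul, dualMap_undual, dualMap_undual]
        have h := f.map_comul z y x =≫ (dualTensor (A.hom x y) (A.hom y z)).hom
        refine Eq.trans ?_ (h.symm.trans (Category.assoc _ _ _))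
        rw [Category.assoc, Category.assoc, Iso.inv_hom_id, Category.comp_id] }

lemma map_unmap (f : DualVCat.Functor (obj A) (obj B)) : map (unmap f) = f :=
  DualVCat.Functor.ext' (fun _ => rfl) fun x y =>
    (dualMap_undual (f.map x y)).trans (Category.id_comp _).symm

/-- Dualizing keeps the object map and is faithful on each hom. Identities between lifted functors
can therefore be checked on their duals. -/
lemma map_injective : Function.Injective (map : VCat.Functor A B → _) := fun f g h => by
  obtain ⟨⟨f, f', _, _⟩⟩ := f
  obtain ⟨⟨g, g', _, _⟩⟩ := g
  obtain rfl : f = g := congrArg DualVCat.Functor.obj h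
  congr
  ext x y : 2
  apply dualMap_injective
  injection h with h₁ h₂
  exact congr_fun₂ h₂ y x

/-- The factors are exchanged because duality reverses tensor products. This gives compatibility of
lifting with vertical composition. -/
lemma undualPoint_lmul {x y z : A.carrier} (p : (obj A).hom x y ⟶ 𝟙_ _)
    (q : (obj A).hom y z ⟶ 𝟙_ _) :
    undualPoint (DualVCat.lmul p q) = VCat.lmul (undualPoint q) (undualPoint p) := by
  apply point_ext
  rw [dualMap_undualPoint, dualMap_lmul, DualVCat.rmul_comp, DualVCat.rmul_eq_lmul,
    dualMap_undualPoint, dualMap_undualPoint]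

/-- The enriched natural transformation with a given dual. -/
noncomputable def unmap₂ {f g : DualVCat.Functor (obj A) (obj B)} (α : DualVCat.NatTrans f g) :
    VCat.NatTrans (unmap f) (unmap g) where
  app x := undualPoint (α.app x)
  naturality x y := by
    change VCat.rmul _ _ = VCat.lmul _ _
    apply dualMap_injective
    rw [dualMap_rmul, dualMap_lmul]
    exact (congrArg₂ DualVCat.lmul (dualMap_undualPoint _) (dualMap_undual _)).trans
      ((α.nat y x).symm.trans
        (congrArg₂ DualVCat.rmul (dualMap_undual _).symm (dualMap_undualPoint _).symm))

end Duality

/-! ### The inverse pseudofunctor. -/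

namespace Duality

variable {k : Type u} [CommRing k]

open FGProjCoalg

variable {A B C : VCat.{w} (FGProjCoalg k)} {D E F : DualVCat.{w} (FGProjAlg k)}

lemma map_comp (f : VCat.Functor A B) (g : VCat.Functor B C) :
    map (f.comp g) = (map f).comp (map g) := rfl

lemma unmap_comp (f : DualVCat.Functor (obj A) (obj B)) (g : DualVCat.Functor (obj B) (obj C)) :
    unmap (f.comp g) = (unmap f).comp (unmap g) :=
  map_injective (by rw [map_comp, map_unmap, map_unmap, map_unmap])

lemma unmap_map (f : VCat.Functor A B) : unmap (map f) = f :=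
  map_injective (map_unmap _)

lemma unmap_id (A : VCat.{w} (FGProjCoalg k)) :
    unmap (DualVCat.Functor.id (obj A)) = VCat.Functor.id A :=
  map_injective (map_unmap _)

/-- The conjugate of a dual functor by the isomorphisms `eval`. -/
noncomputable def conj (f : DualVCat.Functor D E) :
    DualVCat.Functor (obj (predualObj D)) (obj (predualObj E)) :=
  (eval D).comp (f.comp (evalInv E))

lemma evalInv_comp_eval_comp (f : DualVCat.Functor D E) :
    (evalInv D).comp ((eval D).comp f) = f := by
  rw [← DualVCat.Functor.comp_assoc, evalInv_comp_eval, DualVCat.Functor.id_comp]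

/-- The inner `evalInv` and `eval` of `E` cancel as an equality of functors, so the inverse
pseudofunctor needs only equality constraints. -/
lemma conj_comp (f : DualVCat.Functor D E) (g : DualVCat.Functor E F) :
    conj (f.comp g) = (conj f).comp (conj g) := by
  simp only [conj, DualVCat.Functor.comp_assoc, evalInv_comp_eval_comp]

lemma conj_id (D : DualVCat.{w} (FGProjAlg k)) :
    conj (DualVCat.Functor.id D) = DualVCat.Functor.id _ := by
  rw [conj, DualVCat.Functor.id_comp, eval_comp_evalInv]

lemma conj_comp_eval (f : DualVCat.Functor D E) :
    (conj f).comp (eval E) = (eval D).comp f := by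
  rw [conj, DualVCat.Functor.comp_assoc, DualVCat.Functor.comp_assoc, evalInv_comp_eval,
    DualVCat.Functor.comp_id]

lemma evalInv_comp_conj (f : DualVCat.Functor D E) :
    (evalInv D).comp (conj f) = f.comp (evalInv E) :=
  evalInv_comp_eval_comp _

/-- The conjugate of a dual natural transformation by the isomorphisms `eval`. -/
noncomputable def conj₂ {f g : DualVCat.Functor D E} (α : DualVCat.NatTrans f g) :
    DualVCat.NatTrans (conj f) (conj g) :=
  (α.whiskerRight (evalInv E)).whiskerLeft (eval D)

lemma undualPoint_counit (x : A.carrier) : undualPoint ((obj A).counit x) = eId _ x :=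
  point_ext (dualMap_undualPoint _)

/-- The square `conj_comp_eval` for `map f`, lifted through the duality. It commutes strictly, which
supplies the naturality 2-cells of `unitTrans`. -/
lemma unit_natural (f : VCat.Functor A B) :
    (unmap (conj (map f))).comp (unmap (eval (obj B))) = (unmap (eval (obj A))).comp f := by
  rw [← unmap_comp, conj_comp_eval, unmap_comp, unmap_map]

lemma unitInv_natural (f : VCat.Functor A B) :
    f.comp (unmap (evalInv (obj B))) = (unmap (evalInv (obj A))).comp (unmap (conj (map f))) := by
  rw [← unmap_comp, evalInv_comp_conj, unmap_comp, unmap_map]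

lemma counit_natural (f : DualVCat.Functor D E) :
    (map (unmap (conj f))).comp (eval E) = (eval D).comp f := by
  rw [map_unmap, conj_comp_eval]

lemma counitInv_natural (f : DualVCat.Functor D E) :
    f.comp (evalInv E) = (evalInv D).comp (map (unmap (conj f))) := by
  rw [map_unmap, evalInv_comp_conj]

variable (k) in
/-- The action on cells of the pseudofunctor inverse to the duality. -/
noncomputable def predualPrelax :
    PrelaxFunctor (DualVCat.{w} (FGProjAlg k)) (VCat.{w} (FGProjCoalg k)) where
  obj := predualObj
  map f := unmap (conj f)
  map₂ α := unmap₂ (conj₂ α)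
  map₂_id {_ E} f := VCat.cell_ext fun x =>
    -- The object map of `eval` is the identity, so a component of `conj₂ α` is the component of `α`
    -- precomposed with `evalInv`. Functoriality on 2-cells thus says that `evalInv` respects
    -- counits here, and comultiplications below.
    (congrArg undualPoint (DualVCat.Functor.map_counit (evalInv E) (f.obj x)).symm).trans
      (undualPoint_counit (A := predualObj E) (f.obj x))
  map₂_comp {_ E _ _ _} α β := VCat.cell_ext fun x =>
    (congrArg undualPoint (DualVCat.Functor.map_lmul (evalInv E) (α.app x) (β.app x))).trans
      (undualPoint_lmul (A := predualObj E) _ _)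

/-- The unit constraint of the pseudofunctor inverse to the duality. -/
noncomputable def predualMapId (D : DualVCat.{w} (FGProjAlg k)) :
    (predualPrelax k).map (𝟙 D) ≅ 𝟙 ((predualPrelax k).obj D) :=
  VCat.eqIso ((congrArg unmap (conj_id D)).trans (unmap_id _))

/-- The composition constraint of the pseudofunctor inverse to the duality. -/
noncomputable def predualMapComp (f : D ⟶ E) (g : E ⟶ F) :
    (predualPrelax k).map (f ≫ g) ≅ (predualPrelax k).map f ≫ (predualPrelax k).map g :=
  VCat.eqIso ((congrArg unmap (conj_comp f g)).trans (unmap_comp _ _))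

instance : IsEqToHom (predualMapId D).hom :=
  VCat.isEqToHom_eqIso ((congrArg unmap (conj_id D)).trans (unmap_id _))

instance (f : D ⟶ E) (g : E ⟶ F) : IsEqToHom (predualMapComp f g).hom :=
  VCat.isEqToHom_eqIso ((congrArg unmap (conj_comp f g)).trans (unmap_comp _ _))

variable (k) in
/-- The pseudofunctor from dual categories to enriched categories inverse to the duality. -/
noncomputable def predualPseudofunctor :
    Pseudofunctor (DualVCat.{w} (FGProjAlg k)) (VCat.{w} (FGProjCoalg k)) where
  toPrelaxFunctor := predualPrelax k
  mapId D := predualMapId D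
  mapComp f g := predualMapComp f g
  -- Conjugation leaves object maps unchanged, so the whiskered cells have the same components and
  -- only the unit constraints have to be removed.
  map₂_whisker_left {_ _ F} _ {_ _} _ := VCat.cell_ext fun _ =>
    (VCat.lmul_eId_lmul (A := predualObj F) _).symm
  map₂_whisker_right {_ E F f f'} η g := VCat.cell_ext fun x => by
    refine Eq.trans ?_ (VCat.lmul_eId_lmul (A := predualObj F) _).symm
    -- Moving the lifted functor inside `undualPoint` brings the `eval` of `conj g` next to the
    -- `evalInv` of `conj₂ η`, where they cancel.
    refine Eq.trans (congrArg undualPoint ?_) (undualPoint_comp ((conj g).map _ _)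
      ((evalInv E).map _ _ ≫ η.app x))
    refine Eq.trans ?_ (Category.assoc ((evalInv F).map _ _ ≫ g.map _ _) ((eval E).map _ _)
      ((evalInv E).map _ _ ≫ η.app x)).symm
    refine Eq.trans (Category.assoc ((evalInv F).map _ _) (g.map _ _) (η.app x)).symm ?_
    exact congrArg (((evalInv F).map _ _ ≫ g.map _ _) ≫ ·)
      (Iso.inv_hom_id_assoc (predualIso _) (η.app x)).symm
  map₂_associator _ _ _ := IsEqToHom.unique _ _
  map₂_left_unitor _ := IsEqToHom.unique _ _
  map₂_right_unitor _ := IsEqToHom.unique _ _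

instance : (predualPseudofunctor.{w} k).HasStrictConstraints where
  mapId D := inferInstanceAs (IsEqToHom (predualMapId D).hom)
  mapComp f g := inferInstanceAs (IsEqToHom (predualMapComp f g).hom)

/-! ### Comparison of both composites with the identities. -/

open scoped Pseudofunctor.StrongTrans

variable (k)

/-- The transformation from the double dual to the identity of enriched categories. -/
noncomputable def unitTrans :
    (duality.{w} k).toPseudofunctor.comp (predualPseudofunctor k) ⟶ Pseudofunctor.id _ :=
  Pseudofunctor.strongTransOfStrict (fun A => unmap (eval (obj A)))
    (fun f => VCat.eqIso (unit_natural f)) (fun f => VCat.isEqToHom_eqIso (unit_natural f))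
    (fun {_ B _ _} η => VCat.cell_ext fun x => by
      -- The naturality constraints have unit components and drop out. The rest says that
      -- conjugating the dual of `η`, lifting it and composing with the lifted `eval` returns `η`.
      refine (VCat.lmul_eId (A := B) _).trans (Eq.trans ?_ (VCat.lmul_pt_eId (A := B) _).symm)
      refine (undualPoint_comp ((eval (obj B)).map _ _)
        ((evalInv (obj B)).map _ _ ≫ (map₂ η).app x)).symm.trans ?_
      exact (congrArg undualPoint (Iso.inv_hom_id_assoc (predualIso _) ((map₂ η).app x))).trans
        (undualPoint_dualMap (η.app x)))

instance {A B : VCat.{w} (FGProjCoalg k)} (f : A ⟶ B) :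
    IsEqToHom ((unitTrans k).naturality f).hom :=
  VCat.isEqToHom_eqIso (unit_natural f)

/-- The transformation from the identity of enriched categories to the double dual. -/
noncomputable def unitTransInv :
    Pseudofunctor.id _ ⟶ (duality.{w} k).toPseudofunctor.comp (predualPseudofunctor k) :=
  Pseudofunctor.strongTransOfStrict (fun A => unmap (evalInv (obj A)))
    (fun f => VCat.eqIso (unitInv_natural f)) (fun f => VCat.isEqToHom_eqIso (unitInv_natural f))
    (fun {_ B _ _} η => VCat.cell_ext fun x => by
      refine (VCat.lmul_eId (A := predualObj (obj B)) _).trans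
        (Eq.trans ?_ (VCat.lmul_pt_eId (A := predualObj (obj B)) _).symm)
      refine Eq.trans ?_ (undualPoint_comp ((evalInv (obj B)).map _ _) ((map₂ η).app x)).symm
      exact congrArg (· ≫ undual ((evalInv (obj B)).map _ _)) (undualPoint_dualMap (η.app x)).symm)

instance {A B : VCat.{w} (FGProjCoalg k)} (f : A ⟶ B) :
    IsEqToHom ((unitTransInv k).naturality f).hom :=
  VCat.isEqToHom_eqIso (unitInv_natural f)

/-- The transformation from the double dual to the identity of dual categories. -/
noncomputable def counitTrans :
    (predualPseudofunctor.{w} k).comp (duality.{w} k).toPseudofunctor ⟶ Pseudofunctor.id _ :=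
  Pseudofunctor.strongTransOfStrict (fun D => eval D)
    (fun f => DualVCat.eqIso (counit_natural f))
    (fun f => DualVCat.isEqToHom_eqIso (counit_natural f))
    (fun {_ E _ _} η => DualVCat.cell_ext fun x => by
      refine (DualVCat.lmul_pt_counit (C := E) _).trans
        (Eq.trans ?_ (DualVCat.lmul_counit (C := E) _).symm)
      exact (congrArg ((eval E).map _ _ ≫ ·) (dualMap_undualPoint _)).trans
        (Iso.inv_hom_id_assoc (predualIso _) (η.app x)))

instance {D E : DualVCat.{w} (FGProjAlg k)} (f : D ⟶ E) :
    IsEqToHom ((counitTrans k).naturality f).hom :=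
  DualVCat.isEqToHom_eqIso (counit_natural f)

/-- The transformation from the identity of dual categories to the double dual. -/
noncomputable def counitTransInv :
    Pseudofunctor.id _ ⟶ (predualPseudofunctor.{w} k).comp (duality.{w} k).toPseudofunctor :=
  Pseudofunctor.strongTransOfStrict (fun D => evalInv D)
    (fun f => DualVCat.eqIso (counitInv_natural f))
    (fun f => DualVCat.isEqToHom_eqIso (counitInv_natural f))
    (fun {_ E _ _} η => DualVCat.cell_ext fun x => by
      refine (DualVCat.lmul_pt_counit (C := obj (predualObj E)) _).trans
        (Eq.trans ?_ (DualVCat.lmul_counit (C := obj (predualObj E)) _).symm)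
      -- No cancellation is needed here: whiskering `η` with `evalInv` is already what `conj₂` does
      -- on components.
      exact (dualMap_undualPoint _).symm)

instance {D E : DualVCat.{w} (FGProjAlg k)} (f : D ⟶ E) :
    IsEqToHom ((counitTransInv k).naturality f).hom :=
  DualVCat.isEqToHom_eqIso (counitInv_natural f)

variable {k}

lemma unmap_eval_comp_unmap_evalInv (A : VCat.{w} (FGProjCoalg k)) :
    (unmap (eval (obj A))).comp (unmap (evalInv (obj A))) = VCat.Functor.id _ := by
  rw [← unmap_comp, eval_comp_evalInv, unmap_id]

lemma unmap_evalInv_comp_unmap_eval (A : VCat.{w} (FGProjCoalg k)) :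
    (unmap (evalInv (obj A))).comp (unmap (eval (obj A))) = VCat.Functor.id _ := by
  rw [← unmap_comp, evalInv_comp_eval, unmap_id]

end Duality

theorem mainTheorem3 (k : Type u) [CommRing k] :
    IsBiequivalence (Duality.duality.{w, u} k).toPseudofunctor := by
  refine ⟨Duality.predualPseudofunctor k, ⟨?_⟩, ⟨?_⟩⟩
  · exact Pseudofunctor.equivalenceOfStrict (Duality.unitTrans k) (Duality.unitTransInv k)
      (fun A => Duality.unmap_eval_comp_unmap_evalInv A)
      (fun A => Duality.unmap_evalInv_comp_unmap_eval A)
  · exact Pseudofunctor.equivalenceOfStrict (Duality.counitTrans k) (Duality.counitTransInv k)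
      (fun D => Duality.eval_comp_evalInv D) (fun D => Duality.evalInv_comp_eval D)
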